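/- Let $\mathbb T=\mathbb R/\mathbb Z$, let $\varphi:\mathbb T\to(0,\infty)$ be a $C^3$ function with Fourier series $\varphi(x)=\sum_{m\in\mathbb Z}c_m e^{2\pi i m x}$, and let $\alpha\in\mathbb R\setminus\mathbb Q$. For $y\in\mathbb R$ put $\|y\|=\inf_{p\in\mathbb Z}|y-p|$. Assume [H1] there exist real numbers $C_m$, $m\ge 1$, with $\sum_{m=1}^\infty C_m<\infty$ and $\sum_{l=2}^\infty|c_{lm}|^2\le C_m|c_m|^2$ for all $m\ge1$. Suppose that $$\lim_{m\to\infty}\frac{|c_m|}{\|m\alpha\|}=0\qquad\text{and}\qquad \sum_{m\in\mathbb Z\setminus\{0\}}\Bigl(\frac{|c_m|}{\|m\alpha\|}\Bigr)^2=\infty .$$ Then the special flow $T^t_{(\alpha,\varphi)}$ over the rotation $x\mapsto x+\alpha$ of $\mathbb T$ and under the roof function $\varphi$ is weak mixing. Here the special flow acts on $X_\varphi=\{(x,s):x\in\mathbb T,\ 0\le s<\varphi(x)\}$, equipped with the normalized Lebesgue measure $\mu$, by $T^t(x,s)=(x+n\alpha,\ s+t-S_n\varphi(x))$, where $S_n\varphi$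 ($n\in\mathbb Z$) are the Birkhoff sums, i.e. $S_0\varphi=0$ and $S_{n+1}\varphi(x)=S_n\varphi(x)+\varphi(x+n\alpha)$, and $n\in\mathbb Z$ is determined by $S_n\varphi(x)\le s+t<S_{n+1}\varphi(x)$. A flow $(T^t)$ is weak mixing if it preserves $\mu$ and $\frac1\tau\int_0^\tau|\mu(A\cap T^{-t}B)-\mu(A)\mu(B)|\,dt\to0$ as $\tau\to\infty$ for all measurable $A,B$. -/

import Mathlib

open MeasureTheory Filter Topology ProbabilityTheory

noncomputable section

/-- The Birkhoff sums `S_n φ` over the rotation by `α` on `𝕋 = ℝ/ℤ`, for all `n : ℤ`: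
`S_n φ (x) = ∑_{k=0}^{n-1} φ (x + k α)` for `n ≥ 0` and
`S_{-n} φ (x) = -∑_{k=1}^{n} φ (x - k α)` for `n ≥ 1`, so that
`S_{m+n} φ (x) = S_m φ (x) + S_n φ (x + m α)`. -/
def rotationSum (α : ℝ) (φ : UnitAddCircle → ℝ) : ℤ → UnitAddCircle → ℝ
  | Int.ofNat n, x => ∑ k ∈ Finset.range n, φ (x + k • (α : UnitAddCircle))
  | Int.negSucc n, x => -∑ k ∈ Finset.range (n + 1), φ (x - (k + 1) • (α : UnitAddCircle))

/-- The phase space `{(x, s) : 0 ≤ s < φ x}` of the special flow under the roof `φ`. -/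
def specialSpace (φ : UnitAddCircle → ℝ) : Set (UnitAddCircle × ℝ) :=
  {p | 0 ≤ p.2 ∧ p.2 < φ p.1}

/-- Lebesgue measure on the phase space, normalized to be a probability measure. It is
regarded as a measure on `𝕋 × ℝ` which is concentrated on the phase space. -/
def specialMeasure (φ : UnitAddCircle → ℝ) : Measure (UnitAddCircle × ℝ) :=
  ProbabilityTheory.cond volume (specialSpace φ)

/-- The number of passages through the roof: the largest `n : ℤ` with `S_n φ (x) ≤ s + t`.
For a continuous `φ > 0` it exists, and it is the only `n` with
`S_n φ (x) ≤ s + t < S_{n+1} φ (x)`. -/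
def specialIndex (α : ℝ) (φ : UnitAddCircle → ℝ) (t : ℝ) (p : UnitAddCircle × ℝ) : ℤ :=
  sSup {n : ℤ | rotationSum α φ n p.1 ≤ p.2 + t}

/-- The special flow over the rotation by `α` and under the roof `φ`:
`T^t (x, s) = (x + n α, s + t - S_n φ (x))`, where `S_n φ (x) ≤ s + t < S_{n+1} φ (x)`. -/
def specialFlow (α : ℝ) (φ : UnitAddCircle → ℝ) (t : ℝ) (p : UnitAddCircle × ℝ) :
    UnitAddCircle × ℝ :=
  (p.1 + specialIndex α φ t p • (α : UnitAddCircle),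
    p.2 + t - rotationSum α φ (specialIndex α φ t p) p.1)

/-- A flow `T` is weak mixing for the probability measure `μ`: it preserves `μ`, and
`(1/τ) ∫_0^τ |μ (A ∩ T^{-t} B) - μ A μ B| dt → 0` as `τ → ∞` for all measurable `A`, `B`. -/
def IsWeakMixingFlow {X : Type*} [MeasurableSpace X] (μ : Measure X) (T : ℝ → X → X) : Prop :=
  (∀ t, MeasurePreserving (T t) μ μ) ∧
    ∀ A B : Set X, MeasurableSet A → MeasurableSet B →
      Tendsto (fun τ : ℝ => τ⁻¹ * ∫ t in (0 : ℝ)..τ,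
        |μ.real (A ∩ T t ⁻¹' B) - μ.real A * μ.real B|) atTop (𝓝 0)

/-- The `m`-th Fourier coefficient `c_m = ∫ φ (x) e^{-2π i m x} dx` of `φ : 𝕋 → ℝ`. -/
def roofCoeff (φ : UnitAddCircle → ℝ) (m : ℤ) : ℂ :=
  fourierCoeff (fun x : UnitAddCircle => (φ x : ℂ)) m

/-- The regularity condition: there are `C_m` with `∑_{m ≥ 1} C_m < ∞` and
`∑_{l ≥ 2} |c_{l m}|² ≤ C_m |c_m|²` for all `m ≥ 1`. -/
def RegularCoeffs (c : ℤ → ℂ) : Prop :=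
  ∃ C : ℕ → ℝ, Summable C ∧
    ∀ m : ℕ, 1 ≤ m → ∑' l : ℕ, ‖c (((l + 2) * m : ℕ) : ℤ)‖ ^ 2 ≤ C m * ‖c (m : ℤ)‖ ^ 2

end

/-!
By the theorem of Koopman and von Neumann, a flow is weak mixing as soon as it has no nonzero
eigenfunction of mean zero. An eigenfunction of the special flow with eigenvalue `ν` restricts on
the base to a multiple of a unimodular `ψ` with `ψ (x + α) = e^{iνφ(x)} ψ x`, and for `ν = 0`
ergodicity of the rotation makes it constant.

For `ν ≠ 0`, modify `φ` by a coboundary. Regularity and [H1] make `∑ (|c_m| / ‖mα‖)²` converge over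
all `m` except the denominators `q` of the reduced fractions `p / q` with `|qα - p| < 1 / (2q²)`, so
`φ` is cohomologous to its mean plus a series of waves with these frequencies `q_0 < q_1 < …`. They
satisfy `q_n² ≤ q_{n+1}` and `‖q_n α‖ ≍ 1 / q_{n+1}`, so the waves are nearly independent, and the
formal transfer function has coefficients `b_n → 0` with `∑ |b_n|² = ∞`. Greedily, one finds a time
`t` with `tα` close to `0` and `‖q_n t α‖ ≥ 1/4` for `N ≤ n < M`. Up to a small error, the modulus
of `∫ ψ (x + tα) conj(ψ x) dx` is then a product of averages of `x ↦ e^{i Re (d_n e(q_n x))}` with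
`e(x) = e^{2πix}` and `|d_n| ≥ |b_n|`, which is small if `∑_{N ≤ n < M} |b_n|²` is large; but it is
close to `1`, because translations act continuously on `L²`.
-/

open scoped InnerProductSpace ContDiff

section CompactOperators

variable {𝕜 H : Type*} [RCLike 𝕜] [NormedAddCommGroup H] [InnerProductSpace 𝕜 H]

theorem norm_apply_sq_le_of_isPositive {A : H →L[𝕜] H} (hA : A.IsPositive) (x : H) :
    ‖A x‖ ^ 2 ≤ ‖A‖ * A.reApplyInnerSelf x := by
  let c : PreInnerProductSpace.Core 𝕜 H :=
    { inner := fun x y => ⟪A x, y⟫_𝕜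
      conj_inner_symm := fun x y => by rw [inner_conj_symm, hA.inner_left_eq_inner_right]
      re_inner_nonneg := fun x => hA.re_inner_nonneg_left x
      add_left := fun x y z => by rw [map_add, inner_add_left]
      smul_left := fun x y r => by rw [map_smul, inner_smul_left] }
  have cauchy_schwarz : ‖⟪A x, A x⟫_𝕜‖ * ‖⟪A (A x), x⟫_𝕜‖ ≤
      A.reApplyInnerSelf x * RCLike.re ⟪A (A x), A x⟫_𝕜 :=
    @InnerProductSpace.Core.inner_mul_inner_self_le 𝕜 H _ _ _ c x (A x)
  have inner_self : ‖⟪A x, A x⟫_𝕜‖ = ‖A x‖ ^ 2 := by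
    rw [inner_self_eq_norm_sq_to_K, norm_pow, RCLike.norm_ofReal, abs_norm]
  rw [hA.inner_left_eq_inner_right (A x) x, inner_self] at cauchy_schwarz
  have form_bound : RCLike.re ⟪A (A x), A x⟫_𝕜 ≤ ‖A‖ * ‖A x‖ ^ 2 :=
    calc RCLike.re ⟪A (A x), A x⟫_𝕜 ≤ ‖A (A x)‖ * ‖A x‖ := re_inner_le_norm _ _
      _ ≤ ‖A‖ * ‖A x‖ * ‖A x‖ := by gcongr; exact A.le_opNorm _
      _ = ‖A‖ * ‖A x‖ ^ 2 := by ring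
  have form_nonneg : 0 ≤ A.reApplyInnerSelf x := hA.re_inner_nonneg_left x
  rcases (sq_nonneg ‖A x‖).eq_or_lt with hAx | hAx
  · rw [← hAx]; positivity
  · exact le_of_mul_le_mul_right (by nlinarith) hAx

theorem exists_reApplyInnerSelf_le_on_orthogonal_span {A : H →L[𝕜] H} {K : ℝ}
    (hK : ∀ (n : ℕ) (v : Fin n → H), Orthonormal 𝕜 v → ∑ i, A.reApplyInnerSelf (v i) ≤ K)
    {η : ℝ} (hη : 0 < η) :
    ∃ (n : ℕ) (v : Fin n → H),
      ∀ h ∈ (Submodule.span 𝕜 (Set.range v))ᗮ, A.reApplyInnerSelf h ≤ η * ‖h‖ ^ 2 := by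
  let traces : Set ℝ :=
    {y | ∃ (n : ℕ) (v : Fin n → H), Orthonormal 𝕜 v ∧ ∑ i, A.reApplyInnerSelf (v i) = y}
  have traces_bdd : BddAbove traces := ⟨K, by rintro _ ⟨n, v, hv, rfl⟩; exact hK n v hv⟩
  have traces_ne : traces.Nonempty := ⟨_, 0, ![], by simp [Orthonormal, Pairwise], rfl⟩
  obtain ⟨_, ⟨n, v, hv, rfl⟩, hlt⟩ := exists_lt_of_lt_csSup traces_ne (sub_lt_self _ hη)
  refine ⟨n, v, fun h hh => ?_⟩
  have unit_bound : ∀ u ∈ (Submodule.span 𝕜 (Set.range v))ᗮ, ‖u‖ = 1 →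
      A.reApplyInnerSelf u ≤ η := fun u hu hu1 => by
    have hperp : ∀ i, ⟪u, v i⟫_𝕜 = 0 := fun i =>
      Submodule.inner_left_of_mem_orthogonal (Submodule.subset_span (Set.mem_range_self i)) hu
    have := le_csSup traces_bdd
      ⟨n + 1, Matrix.vecCons u v, orthonormal_vecCons_iff.2 ⟨hu1, hperp, hv⟩, rfl⟩
    rw [Fin.sum_univ_succ] at this
    simp only [Matrix.cons_val_zero, Matrix.cons_val_succ] at this
    linarith
  rcases eq_or_ne h 0 with rfl | h0
  · simp [ContinuousLinearMap.reApplyInnerSelf_apply]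
  · have := unit_bound (((‖h‖⁻¹ : ℝ) : 𝕜) • h) (Submodule.smul_mem _ _ hh)
      (by rw [norm_smul]; simp [h0])
    rwa [A.reApplyInnerSelf_smul, RCLike.norm_ofReal, abs_inv, abs_norm, inv_pow,
      inv_mul_le_iff₀ (by positivity), mul_comm] at this

theorem norm_sub_comp_starProjection_le {A : H →L[𝕜] H} (hA : A.IsPositive) (V : Submodule 𝕜 H)
    [V.HasOrthogonalProjection] {η : ℝ} (hη : 0 ≤ η)
    (hV : ∀ h ∈ Vᗮ, A.reApplyInnerSelf h ≤ η * ‖h‖ ^ 2) :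
    ‖A - A ∘L V.starProjection‖ ≤ √(‖A‖ * η) := by
  refine ContinuousLinearMap.opNorm_le_bound _ (Real.sqrt_nonneg _) fun h => ?_
  set u := h - V.starProjection h with hu
  have hu_mem : u ∈ Vᗮ := V.sub_starProjection_mem_orthogonal h
  have hu_norm : ‖u‖ ≤ ‖h‖ := by
    rw [hu, ← Submodule.starProjection_orthogonal_val]
    exact Submodule.norm_starProjection_apply_le _ _
  have hAu : (A - A ∘L V.starProjection) h = A u := by simp [hu]
  rw [hAu]
  refine abs_le_of_sq_le_sq' ?_ (by positivity) |>.2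
  calc ‖A u‖ ^ 2 ≤ ‖A‖ * A.reApplyInnerSelf u := norm_apply_sq_le_of_isPositive hA u
    _ ≤ ‖A‖ * (η * ‖h‖ ^ 2) := by gcongr; exact (hV u hu_mem).trans (by gcongr)
    _ = (√(‖A‖ * η) * ‖h‖) ^ 2 := by rw [mul_pow, Real.sq_sqrt (by positivity), mul_assoc]

theorem isCompactOperator_of_sum_reApplyInnerSelf_le [CompleteSpace H] {A : H →L[𝕜] H}
    (hA : A.IsPositive) {K : ℝ}
    (hK : ∀ (n : ℕ) (v : Fin n → H), Orthonormal 𝕜 v → ∑ i, A.reApplyInnerSelf (v i) ≤ K) :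
    IsCompactOperator A := by
  refine (isClosed_setOfPred_isCompactOperator (σ₁₂ := RingHom.id 𝕜)).closure_subset
    (Metric.mem_closure_iff.2 fun ε hε => ?_)
  obtain ⟨η, hη, hηε⟩ : ∃ η : ℝ, 0 < η ∧ ‖A‖ * η < ε ^ 2 :=
    exists_pos_mul_lt (by positivity) ‖A‖
  obtain ⟨n, v, hv⟩ := exists_reApplyInnerSelf_le_on_orthogonal_span hK hη
  let V := Submodule.span 𝕜 (Set.range v)
  have : FiniteDimensional 𝕜 V := FiniteDimensional.span_of_finite 𝕜 (Set.finite_range v)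
  have : ProperSpace V := FiniteDimensional.proper_rclike 𝕜 V
  have finite_rank : IsCompactOperator (A ∘L V.subtypeL) :=
    isCompactOperator_of_locallyCompactSpace_rng (A ∘L V.subtypeL)
  refine ⟨A ∘L V.starProjection, finite_rank.comp_clm V.orthogonalProjectionOnto, ?_⟩
  rw [dist_eq_norm]
  exact (norm_sub_comp_starProjection_le hA V hη.le hv).trans_lt ((Real.sqrt_lt' hε).2 hηε)

end CompactOperators

theorem exists_joint_eigenvector_of_commute {K V ι : Type*} [Field K] [IsAlgClosed K]
    [AddCommGroup V] [Module K V] [FiniteDimensional K V] [Nontrivial V]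
    (U : ι → Module.End K V) (hU : ∀ i j, Commute (U i) (U j)) :
    ∃ h ≠ 0, ∃ χ : ι → K, ∀ i, U i h = χ i • h := by
  induction hn : Module.finrank K V using Nat.strong_induction_on generalizing V with
  | h n ih =>
  by_cases hscalar : ∀ i, ∃ μ : K, ∀ x, U i x = μ • x
  · choose χ hχ using hscalar
    obtain ⟨h, hh⟩ := exists_ne (0 : V)
    exact ⟨h, hh, χ, fun i => hχ i h⟩
  push Not at hscalar
  obtain ⟨i, hi⟩ := hscalar
  obtain ⟨μ, hμ⟩ := Module.End.exists_eigenvalue (U i)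
  let W := (U i).eigenspace μ
  have hW_ne_top : W ≠ ⊤ := fun htop => by
    obtain ⟨x, hx⟩ := hi μ
    exact hx (Module.End.mem_eigenspace_iff.1 (show x ∈ W from htop ▸ Submodule.mem_top))
  have : Nontrivial W := Submodule.nontrivial_iff_ne_bot.2 hμ
  have hmaps : ∀ j, Set.MapsTo (U j) W W := fun j =>
    Module.End.mapsTo_genEigenspace_of_comm (hU i j) μ 1
  obtain ⟨h, hh, χ, hχ⟩ := ih _ (hn ▸ Submodule.finrank_lt hW_ne_top)
    (fun j => (U j).restrict (hmaps j))
    (fun j k => LinearMap.ext fun x => Subtype.ext (LinearMap.congr_fun (hU j k) (x : V))) rfl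
  exact ⟨h, by simpa using hh, χ, fun j => congrArg Subtype.val (hχ j)⟩

theorem exists_joint_eigenvector_of_commute_compact {H ι : Type*} [NormedAddCommGroup H]
    [InnerProductSpace ℂ H] [CompleteSpace H] (U : ι → H →L[ℂ] H)
    (hU : ∀ i j, Commute (U i) (U j)) {A : H →L[ℂ] H} (hA : A.IsSymmetric)
    (hc : IsCompactOperator A) (h0 : A ≠ 0) (hAU : ∀ i, Commute A (U i)) :
    ∃ (h : H) (a : ℂ) (χ : ι → ℂ), h ≠ 0 ∧ a ≠ 0 ∧ A h = a • h ∧ ∀ i, U i h = χ i • h := by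
  obtain ⟨a, ha, ha0⟩ : ∃ a, Module.End.HasEigenvalue (A : Module.End ℂ H) a ∧ a ≠ 0 := by
    by_contra! hcon
    exact h0 ((ContinuousLinearMap.eq_zero_of_forall_hasEigenvalue_eq_zero hc hA).1 hcon)
  let E := Module.End.eigenspace (A : Module.End ℂ H) a
  have : FiniteDimensional ℂ E := ContinuousLinearMap.finite_dimensional_eigenspace hc a ha0
  have : Nontrivial E := Submodule.nontrivial_iff_ne_bot.2 ha
  have hmaps : ∀ i, Set.MapsTo (U i : Module.End ℂ H) E E := fun i =>
    Module.End.mapsTo_genEigenspace_of_comm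
      (LinearMap.ext fun x => DFunLike.congr_fun (hAU i) x) a 1
  obtain ⟨h, hh, χ, hχ⟩ := exists_joint_eigenvector_of_commute
    (fun i => (U i : Module.End ℂ H).restrict (hmaps i))
    (fun i j => LinearMap.ext fun x => Subtype.ext (DFunLike.congr_fun (hU i j) (x : H)))
  exact ⟨h, a, χ, by simpa using hh, ha0, Module.End.mem_eigenspace_iff.1 h.2,
    fun i => congrArg Subtype.val (hχ i)⟩

theorem exists_clm_tendsto_inner {H ι : Type*} [NormedAddCommGroup H] [InnerProductSpace ℂ H]
    [CompleteSpace H] (𝓕 : Ultrafilter ι) (B : ι → H →ₗ⋆[ℂ] H →ₗ[ℂ] ℂ) {C : ℝ}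
    (hB : ∀ᶠ i in (𝓕 : Filter ι), ∀ x y, ‖B i x y‖ ≤ C * ‖x‖ * ‖y‖) :
    ∃ A : H →L[ℂ] H, ∀ x y, Tendsto (fun i => B i x y) 𝓕 (𝓝 ⟪A x, y⟫_ℂ) := by
  have exists_limit : ∀ x y : H, ∃ b : ℂ, Tendsto (fun i => B i x y) 𝓕 (𝓝 b) := fun x y => by
    obtain ⟨b, -, hb⟩ := (isCompact_closedBall (0 : ℂ) (C * ‖x‖ * ‖y‖)).ultrafilter_le_nhds
      (𝓕.map fun i => B i x y)
      (le_principal_iff.2 (hB.mono fun i hi => mem_closedBall_zero_iff.2 (hi x y)))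
    exact ⟨b, hb⟩
  choose b hb using exists_limit
  have norm_b_le : ∀ x y, ‖b x y‖ ≤ C * ‖x‖ * ‖y‖ := fun x y =>
    le_of_tendsto (hb x y).norm (hB.mono fun i hi => hi x y)
  let b_form : H →ₗ⋆[ℂ] H →ₗ[ℂ] ℂ := LinearMap.mk₂'ₛₗ (starRingEnd ℂ) (RingHom.id ℂ) b
    (fun x x' y => tendsto_nhds_unique (hb _ _)
      (((hb x y).add (hb x' y)).congr fun i => by simp))
    (fun c x y => tendsto_nhds_unique (hb _ _) (((hb x y).const_mul _).congr fun i => by simp))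
    (fun x y y' => tendsto_nhds_unique (hb _ _)
      (((hb x y).add (hb x y')).congr fun i => by simp))
    (fun c x y => tendsto_nhds_unique (hb _ _) (((hb x y).const_mul _).congr fun i => by simp))
  refine ⟨InnerProductSpace.continuousLinearMapOfBilin (b_form.mkContinuous₂ C norm_b_le),
    fun x y => ?_⟩
  rw [InnerProductSpace.continuousLinearMapOfBilin_apply]
  exact hb x y

section KoopmanVonNeumann

open scoped ComplexOrder

variable {H : Type*} [NormedAddCommGroup H] [InnerProductSpace ℂ H]

/-- The average over `0 ≤ t ≤ τ` of the rank one forms `⟪g, U t f⟫ ⟪U t f, h⟫` along the orbit of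
`f`; on the diagonal it is the mean square of a correlation. -/
noncomputable def orbitForm (U : ℝ → H →ₗᵢ[ℂ] H) (f : H) (τ : ℝ) (g h : H) : ℂ :=
  (τ : ℂ)⁻¹ * ∫ t in (0 : ℝ)..τ, ⟪g, U t f⟫_ℂ * ⟪U t f, h⟫_ℂ

variable {U : ℝ → H →ₗᵢ[ℂ] H}

theorem norm_orbit_inner_mul_le (f g h : H) (t : ℝ) :
    ‖⟪g, U t f⟫_ℂ * ⟪U t f, h⟫_ℂ‖ ≤ ‖f‖ ^ 2 * ‖g‖ * ‖h‖ :=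
  calc ‖⟪g, U t f⟫_ℂ * ⟪U t f, h⟫_ℂ‖ ≤ (‖g‖ * ‖U t f‖) * (‖U t f‖ * ‖h‖) := by
        rw [norm_mul]; gcongr <;> exact norm_inner_le_norm _ _
    _ = ‖f‖ ^ 2 * ‖g‖ * ‖h‖ := by rw [(U t).norm_map]; ring

theorem intervalIntegrable_orbit_inner_mul
    (hmeas : ∀ f g : H, Measurable fun t => ⟪g, U t f⟫_ℂ) (f g h : H) (a b : ℝ) :
    IntervalIntegrable (fun t => ⟪g, U t f⟫_ℂ * ⟪U t f, h⟫_ℂ) volume a b := by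
  have measurable_right : Measurable fun t => ⟪U t f, h⟫_ℂ := by
    simp_rw [← inner_conj_symm (U _ f) h]
    exact Complex.continuous_conj.measurable.comp (hmeas f h)
  exact (intervalIntegrable_const (c := ‖f‖ ^ 2 * ‖g‖ * ‖h‖)).mono_fun
    ((hmeas f g).mul measurable_right).aestronglyMeasurable
    (ae_of_all _ fun t => (norm_orbit_inner_mul_le f g h t).trans (Real.le_norm_self _))

theorem norm_orbitForm_le (f g h : H) {τ : ℝ} (hτ : 0 < τ) :
    ‖orbitForm U f τ g h‖ ≤ ‖f‖ ^ 2 * ‖g‖ * ‖h‖ := by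
  have := intervalIntegral.norm_integral_le_of_norm_le_const (a := 0) (b := τ)
    (fun t _ => norm_orbit_inner_mul_le (U := U) f g h t)
  rw [sub_zero, abs_of_pos hτ] at this
  rwa [orbitForm, norm_mul, norm_inv, Complex.norm_real, Real.norm_of_nonneg hτ.le,
    inv_mul_le_iff₀' hτ]

theorem orbitForm_self (f g : H) (τ : ℝ) :
    orbitForm U f τ g g = ((τ⁻¹ * ∫ t in (0 : ℝ)..τ, ‖⟪g, U t f⟫_ℂ‖ ^ 2 : ℝ) : ℂ) := by
  rw [orbitForm, Complex.ofReal_mul, ← intervalIntegral.integral_ofReal, Complex.ofReal_inv]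
  congr 1
  refine intervalIntegral.integral_congr fun t _ => ?_
  rw [← inner_conj_symm (U t f) g, Complex.mul_conj, Complex.normSq_eq_norm_sq]

theorem orbitForm_self_nonneg (f g : H) {τ : ℝ} (hτ : 0 ≤ τ) : 0 ≤ orbitForm U f τ g g := by
  rw [orbitForm_self, Complex.zero_le_real]
  exact mul_nonneg (inv_nonneg.2 hτ)
    (intervalIntegral.integral_nonneg hτ fun t _ => sq_nonneg _)

theorem exists_orbitForm_eq (hmeas : ∀ f g : H, Measurable fun t => ⟪g, U t f⟫_ℂ) (f : H)
    (τ : ℝ) : ∃ B : H →ₗ⋆[ℂ] H →ₗ[ℂ] ℂ, ∀ g h, B g h = orbitForm U f τ g h := by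
  have hInt := fun g h => intervalIntegrable_orbit_inner_mul hmeas f g h 0 τ
  refine ⟨LinearMap.mk₂'ₛₗ (starRingEnd ℂ) (RingHom.id ℂ) (orbitForm U f τ)
    (fun g g' h => ?_) (fun c g h => ?_) (fun g h h' => ?_) (fun c g h => ?_), fun g h => rfl⟩
  · simp only [orbitForm, inner_add_left, add_mul]
    rw [intervalIntegral.integral_add (hInt g h) (hInt g' h), mul_add]
  · simp only [orbitForm, inner_smul_left, mul_assoc, smul_eq_mul]
    rw [intervalIntegral.integral_const_mul, mul_left_comm]
  · simp only [orbitForm, inner_add_right, mul_add]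
    rw [intervalIntegral.integral_add (hInt g h) (hInt g h'), mul_add]
  · simp only [orbitForm, inner_smul_right, mul_left_comm _ c, RingHom.id_apply, smul_eq_mul]
    rw [intervalIntegral.integral_const_mul, mul_left_comm]

theorem sum_orbitForm_self_le (hmeas : ∀ f g : H, Measurable fun t => ⟪g, U t f⟫_ℂ) (f : H)
    {ι : Type*} [Fintype ι] {v : ι → H} (hv : Orthonormal ℂ v) {τ : ℝ} (hτ : 0 < τ) :
    ∑ i, (orbitForm U f τ (v i) (v i)).re ≤ ‖f‖ ^ 2 := by
  have hInt : ∀ i ∈ Finset.univ,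
      IntervalIntegrable (fun t => ‖⟪v i, U t f⟫_ℂ‖ ^ 2) volume 0 τ := fun i _ => by
    refine (intervalIntegrable_const (c := (‖v i‖ * ‖f‖) ^ 2)).mono_fun
      ((hmeas f (v i)).norm.pow_const 2).aestronglyMeasurable (ae_of_all _ fun t => ?_)
    beta_reduce
    rw [Real.norm_of_nonneg (by positivity), Real.norm_of_nonneg (by positivity)]
    gcongr
    simpa using norm_inner_le_norm (v i) (U t f)
  simp_rw [orbitForm_self, Complex.ofReal_re]
  rw [← Finset.mul_sum, ← intervalIntegral.integral_finsetSum hInt, inv_mul_le_iff₀ hτ]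
  have bessel : ∀ t ∈ Set.Icc 0 τ, ∑ i, ‖⟪v i, U t f⟫_ℂ‖ ^ 2 ≤ ‖f‖ ^ 2 := fun t _ => by
    simpa using hv.sum_inner_products_le (U t f) (s := Finset.univ)
  have := intervalIntegral.integral_mono_on hτ.le
    (by simpa only [Finset.sum_fn] using IntervalIntegrable.sum Finset.univ hInt)
    (intervalIntegrable_const (c := ‖f‖ ^ 2)) bessel
  simpa using this

theorem tendsto_orbitForm_map_sub_orbitForm (hadd : ∀ s t x, U (s + t) x = U s (U t x))
    (hmeas : ∀ f g : H, Measurable fun t => ⟪g, U t f⟫_ℂ) (f g h : H) (s : ℝ) :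
    Tendsto (fun τ => orbitForm U f τ (U s g) (U s h) - orbitForm U f τ g h) atTop (𝓝 0) := by
  set k : ℝ → ℂ := fun t => ⟪g, U t f⟫_ℂ * ⟪U t f, h⟫_ℂ
  set C := ‖f‖ ^ 2 * ‖g‖ * ‖h‖
  have translate : ∀ t, ⟪U s g, U t f⟫_ℂ * ⟪U t f, U s h⟫_ℂ = k (t - s) := fun t => by
    have : U t f = U s (U (t - s) f) := by rw [← hadd, add_sub_cancel]
    rw [this, (U s).inner_map_map, (U s).inner_map_map]
  have hInt : ∀ a b, IntervalIntegrable k volume a b :=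
    intervalIntegrable_orbit_inner_mul hmeas f g h
  have norm_integral_le : ∀ a b, ‖∫ t in a..b, k t‖ ≤ C * |b - a| := fun a b =>
    intervalIntegral.norm_integral_le_of_norm_le_const fun t _ => norm_orbit_inner_mul_le f g h t
  have boundary_terms : ∀ τ, orbitForm U f τ (U s g) (U s h) - orbitForm U f τ g h =
      (τ : ℂ)⁻¹ * ((∫ t in (-s)..0, k t) - ∫ t in (τ - s)..τ, k t) := fun τ => by
    rw [orbitForm, orbitForm, ← mul_sub]
    congr 1
    simp_rw [translate]
    rw [intervalIntegral.integral_comp_sub_right k s, zero_sub]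
    have e1 := intervalIntegral.integral_add_adjacent_intervals (hInt (-s) 0) (hInt 0 τ)
    have e2 := intervalIntegral.integral_add_adjacent_intervals (hInt (-s) (τ - s)) (hInt (τ - s) τ)
    linear_combination e2 - e1
  refine squeeze_zero_norm' (a := fun τ : ℝ => τ⁻¹ * (C * |s| + C * |s|)) ?_
    (by simpa using tendsto_inv_atTop_zero.mul_const (C * |s| + C * |s|))
  filter_upwards [eventually_gt_atTop 0] with τ hτ
  rw [boundary_terms, norm_mul, norm_inv, Complex.norm_real, Real.norm_of_nonneg hτ.le]
  gcongr
  refine (norm_sub_le _ _).trans (add_le_add ?_ ?_)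
  · simpa using norm_integral_le (-s) 0
  · simpa using norm_integral_le (τ - s) τ

section OrbitFormLimit

variable {𝓕 : Filter ℝ} [NeBot 𝓕] {f : H} {A : H →L[ℂ] H}

theorem isPositive_of_tendsto_orbitForm (h𝓕 : 𝓕 ≤ atTop)
    (hA : ∀ x y, Tendsto (fun τ => orbitForm U f τ x y) 𝓕 (𝓝 ⟪A x, y⟫_ℂ)) : A.IsPositive := by
  rw [← ContinuousLinearMap.isPositive_toLinearMap_iff, LinearMap.isPositive_iff_complex]
  intro x
  have : 0 ≤ ⟪A x, x⟫_ℂ := ge_of_tendsto (hA x x) <|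
    h𝓕 ((eventually_ge_atTop 0).mono fun τ hτ => orbitForm_self_nonneg f x hτ)
  exact ⟨(Complex.eq_re_of_ofReal_le this).symm, (Complex.le_def.1 this).1⟩

theorem isCompactOperator_of_tendsto_orbitForm [CompleteSpace H] (h𝓕 : 𝓕 ≤ atTop)
    (hmeas : ∀ f g : H, Measurable fun t => ⟪g, U t f⟫_ℂ)
    (hA : ∀ x y, Tendsto (fun τ => orbitForm U f τ x y) 𝓕 (𝓝 ⟪A x, y⟫_ℂ)) :
    IsCompactOperator A := by
  refine isCompactOperator_of_sum_reApplyInnerSelf_le (isPositive_of_tendsto_orbitForm h𝓕 hA)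
    (K := ‖f‖ ^ 2) fun n v hv => ?_
  refine le_of_tendsto (tendsto_finsetSum _ fun i _ =>
    (Complex.continuous_re.tendsto _).comp (hA (v i) (v i))) ?_
  exact h𝓕 ((eventually_gt_atTop 0).mono fun τ hτ => sum_orbitForm_self_le hmeas f hv hτ)

theorem apply_map_of_tendsto_orbitForm (h𝓕 : 𝓕 ≤ atTop)
    (hadd : ∀ s t x, U (s + t) x = U s (U t x))
    (hmeas : ∀ f g : H, Measurable fun t => ⟪g, U t f⟫_ℂ)
    (hA : ∀ x y, Tendsto (fun τ => orbitForm U f τ x y) 𝓕 (𝓝 ⟪A x, y⟫_ℂ)) (s : ℝ) (x : H) :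
    A (U s x) = U s (A x) := by
  have invariant : ∀ y, ⟪A (U s x), U s y⟫_ℂ = ⟪A x, y⟫_ℂ := fun y =>
    sub_eq_zero.1 <| tendsto_nhds_unique ((hA (U s x) (U s y)).sub (hA x y))
      ((tendsto_orbitForm_map_sub_orbitForm hadd hmeas f x y s).mono_left h𝓕)
  have map_zero : ∀ y, U 0 y = y := fun y => (U 0).injective (by rw [← hadd, add_zero])
  refine ext_inner_right ℂ fun y => ?_
  have hy : y = U s (U (-s) y) := by rw [← hadd, add_neg_cancel, map_zero]
  rw [hy, invariant, (U s).inner_map_map]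

theorem inner_apply_eq_zero_of_tendsto_orbitForm
    (hA : ∀ x y, Tendsto (fun τ => orbitForm U f τ x y) 𝓕 (𝓝 ⟪A x, y⟫_ℂ)) {v : H}
    (hv : ∀ t, ⟪U t f, v⟫_ℂ = 0) (x : H) : ⟪A x, v⟫_ℂ = 0 :=
  tendsto_nhds_unique (hA x v) (tendsto_const_nhds.congr fun τ => by simp [orbitForm, hv])

end OrbitFormLimit

/-- The eigenvector comes from a weak limit of the orbit forms along an ultrafilter: that operator
is positive and compact, it commutes with `U`, and its value at `(g, g)` is a nonzero mean
square. -/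
theorem exists_joint_eigenvector_of_not_tendsto [CompleteSpace H]
    (hadd : ∀ s t x, U (s + t) x = U s (U t x))
    (hmeas : ∀ f g : H, Measurable fun t => ⟪g, U t f⟫_ℂ) {f g : H}
    (hnot : ¬ Tendsto (fun τ : ℝ => τ⁻¹ * ∫ t in (0 : ℝ)..τ, ‖⟪g, U t f⟫_ℂ‖ ^ 2) atTop (𝓝 0)) :
    ∃ (h : H) (χ : ℝ → ℂ), h ≠ 0 ∧ (∀ t, U t h = χ t • h) ∧
      ∀ v, (∀ t, ⟪U t f, v⟫_ℂ = 0) → ⟪h, v⟫_ℂ = 0 := by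
  have not_tendsto_form : ¬ Tendsto (fun τ => orbitForm U f τ g g) atTop (𝓝 0) := fun h =>
    hnot (by simpa [Function.comp_def, orbitForm_self] using
      (Complex.continuous_re.tendsto 0).comp h)
  obtain ⟨𝓕, h𝓕, h𝓕g⟩ : ∃ 𝓕 : Ultrafilter ℝ, (𝓕 : Filter ℝ) ≤ atTop ∧
      ¬ Tendsto (fun τ => orbitForm U f τ g g) 𝓕 (𝓝 0) := by
    by_contra! h
    exact not_tendsto_form (tendsto_iff_ultrafilter _ _ _ |>.2 h)
  choose B hB using exists_orbitForm_eq hmeas f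
  obtain ⟨A, hA⟩ := exists_clm_tendsto_inner 𝓕 B (C := ‖f‖ ^ 2)
    (h𝓕 ((eventually_gt_atTop 0).mono fun τ hτ x y => hB τ x y ▸ norm_orbitForm_le f x y hτ))
  simp only [hB] at hA
  have A_ne_zero : A ≠ 0 := fun h0 => h𝓕g (by simpa [h0] using hA g g)
  obtain ⟨h, a, χ, hh0, ha0, hAh, hχ⟩ := exists_joint_eigenvector_of_commute_compact
    (fun t => (U t).toContinuousLinearMap)
    (fun s t => ContinuousLinearMap.ext fun x =>
      show U s (U t x) = U t (U s x) by rw [← hadd, ← hadd, add_comm])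
    (isPositive_of_tendsto_orbitForm h𝓕 hA).isSymmetric
    (isCompactOperator_of_tendsto_orbitForm h𝓕 hmeas hA) A_ne_zero
    (fun s => ContinuousLinearMap.ext (apply_map_of_tendsto_orbitForm h𝓕 hadd hmeas hA s))
  refine ⟨h, χ, hh0, hχ, fun v hv => ?_⟩
  have := inner_apply_eq_zero_of_tendsto_orbitForm hA hv h
  rw [hAh, inner_smul_left] at this
  exact (mul_eq_zero.1 this).resolve_left (by simpa using ha0)

end KoopmanVonNeumann

section Characters

theorem differentiable_of_measurable_character {χ : ℝ → ℂ} (hm : Measurable χ)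
    (hadd : ∀ s t, χ (s + t) = χ s * χ t) (hnorm : ∀ t, ‖χ t‖ = 1) : Differentiable ℝ χ := by
  have locallyIntegrable : ∀ {ψ : ℝ → ℂ}, Measurable ψ → (∀ t, ‖ψ t‖ = 1) →
      LocallyIntegrable ψ := fun hψ hψ1 =>
    (locallyIntegrable_const (1 : ℝ)).mono hψ.aestronglyMeasurable
      (ae_of_all _ fun t => by simp [hψ1])
  obtain ⟨g, hg, hgc, hc⟩ : ∃ g : ℝ → ℝ, ContDiff ℝ ∞ g ∧ HasCompactSupport g ∧
      ∫ u, g u • χ (-u) ≠ 0 := by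
    by_contra! hcon
    obtain ⟨t, ht⟩ := (ae_eq_zero_of_integral_contDiff_smul_eq_zero
      (locallyIntegrable (hm.comp measurable_neg) fun t => hnorm (-t)) hcon).exists
    exact zero_ne_one (by rw [← hnorm (-t), show χ (-t) = 0 from ht, norm_zero])
  have convolution_eq : ∀ t, (convolution g χ (ContinuousLinearMap.lsmul ℝ ℝ) volume) t =
      (∫ u, g u • χ (-u)) * χ t := fun t => by
    rw [convolution_lsmul, ← integral_mul_const]
    simp only [sub_eq_add_neg, add_comm t, hadd, smul_mul_assoc]
  have eq_convolution : χ = fun t => (∫ u, g u • χ (-u))⁻¹ *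
      (convolution g χ (ContinuousLinearMap.lsmul ℝ ℝ) volume) t := funext fun t => by
    rw [convolution_eq, inv_mul_cancel_left₀ hc]
  rw [eq_convolution]
  exact ((hgc.contDiff_convolution_left _ hg (locallyIntegrable hm hnorm)).differentiable
    (by simp)).const_mul _

theorem eq_cexp_of_hasDerivAt {χ : ℝ → ℂ} {z : ℂ} (hderiv : ∀ t, HasDerivAt χ (z * χ t) t)
    (h0 : χ 0 = 1) (t : ℝ) : χ t = Complex.exp (z * t) := by
  have hasDerivAt_quotient : ∀ t : ℝ,
      HasDerivAt (fun t : ℝ => χ t * Complex.exp (-(z * t))) 0 t := fun t => by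
    have hexp : HasDerivAt (fun t : ℝ => Complex.exp (-(z * t)))
        (Complex.exp (-(z * t)) * (-(z * 1))) t :=
      ((Complex.ofRealCLM.hasDerivAt (x := t)).const_mul z).neg.cexp
    exact ((hderiv t).mul hexp).congr_deriv (by ring)
  have := is_const_of_deriv_eq_zero (fun t => (hasDerivAt_quotient t).differentiableAt)
    (fun t => (hasDerivAt_quotient t).deriv) t 0
  simp only [Complex.ofReal_zero, mul_zero, neg_zero, Complex.exp_zero, mul_one, h0,
    Complex.exp_neg] at this
  exact (mul_inv_eq_one₀ (Complex.exp_ne_zero _)).1 this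

theorem exists_eq_cexp_of_measurable_character {χ : ℝ → ℂ} (hm : Measurable χ)
    (hadd : ∀ s t, χ (s + t) = χ s * χ t) (hnorm : ∀ t, ‖χ t‖ = 1) :
    ∃ ν : ℝ, ∀ t, χ t = Complex.exp (ν * t * Complex.I) := by
  have hne : χ 0 ≠ 0 := norm_ne_zero_iff.1 (by simp [hnorm])
  have h0 : χ 0 = 1 := mul_left_cancel₀ hne (by rw [← hadd, add_zero, mul_one])
  have hderiv : ∀ t, HasDerivAt χ (deriv χ 0 * χ t) t := fun t => by
    have hχ0 : HasDerivAt χ (deriv χ 0) (t - t) := by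
      rw [sub_self]
      exact (differentiable_of_measurable_character hm hadd hnorm 0).hasDerivAt
    refine ((hχ0.comp_sub_const t t).mul_const (χ t)).congr_of_eventuallyEq
      (Eventually.of_forall fun s => ?_)
    beta_reduce
    rw [← hadd, sub_add_cancel]
  have re_eq_zero : (deriv χ 0).re = 0 := by
    have := hnorm 1
    rw [eq_cexp_of_hasDerivAt hderiv h0, Complex.norm_exp] at this
    simpa using this
  refine ⟨(deriv χ 0).im, fun t => ?_⟩
  rw [eq_cexp_of_hasDerivAt hderiv h0]
  congr 1
  apply Complex.ext <;> simp [re_eq_zero]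

end Characters

section SpecialFlow

variable {α : ℝ} {φ : UnitAddCircle → ℝ}

theorem rotationSum_zero (x : UnitAddCircle) : rotationSum α φ 0 x = 0 := by
  change rotationSum α φ (Int.ofNat 0) x = 0
  simp [rotationSum]

theorem rotationSum_add_one (n : ℤ) (x : UnitAddCircle) :
    rotationSum α φ (n + 1) x = rotationSum α φ n x + φ (x + n • (α : UnitAddCircle)) := by
  rcases n with n | n
  · change rotationSum α φ (Int.ofNat (n + 1)) x = _
    simp [rotationSum, Finset.sum_range_succ]
  · rcases n with _ | n
    · change rotationSum α φ 0 x = _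
      rw [rotationSum_zero]
      simp [rotationSum, sub_eq_add_neg]
    · have : Int.negSucc (n + 1) + 1 = Int.negSucc n := rfl
      rw [this]
      simp only [rotationSum, negSucc_zsmul]
      rw [Finset.sum_range_succ _ (n + 1), ← sub_eq_add_neg]
      ring_nf

theorem rotationSum_add (m n : ℤ) (x : UnitAddCircle) :
    rotationSum α φ (m + n) x =
      rotationSum α φ m x + rotationSum α φ n (x + m • (α : UnitAddCircle)) := by
  induction n using Int.induction_on with
  | zero => simp [rotationSum_zero]
  | succ n ih =>
    rw [← add_assoc, rotationSum_add_one, ih, rotationSum_add_one, add_assoc, add_smul, add_assoc]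
  | pred n ih =>
    have lhs_step := rotationSum_add_one (α := α) (φ := φ) (m + (-n - 1)) x
    have rhs_step := rotationSum_add_one (α := α) (φ := φ) (-n - 1) (x + m • (α : UnitAddCircle))
    rw [show m + (-(n : ℤ) - 1) + 1 = m + -n by ring, ih] at lhs_step
    rw [show -(n : ℤ) - 1 + 1 = -n by ring] at rhs_step
    rw [add_smul m, ← add_assoc] at lhs_step
    linarith

theorem continuous_rotationSum (hφ : Continuous φ) (n : ℤ) : Continuous (rotationSum α φ n) := by
  rcases n with n | n
  · change Continuous fun x => ∑ k ∈ Finset.range n, φ (x + k • (α : UnitAddCircle))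
    fun_prop
  · change Continuous fun x => -∑ k ∈ Finset.range (n + 1), φ (x - (k + 1) • (α : UnitAddCircle))
    fun_prop

/-- The action of `ℤ` on `𝕋 × ℝ` generated by `(x, s) ↦ (x + α, s - φ x)`. The phase space is a
fundamental domain, and the special flow is the vertical translation flow on the quotient. -/
def towerShift (α : ℝ) (φ : UnitAddCircle → ℝ) (n : ℤ) (p : UnitAddCircle × ℝ) :
    UnitAddCircle × ℝ :=
  (p.1 + n • (α : UnitAddCircle), p.2 - rotationSum α φ n p.1)

theorem towerShift_zero (p : UnitAddCircle × ℝ) : towerShift α φ 0 p = p := by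
  simp [towerShift, rotationSum_zero]

theorem towerShift_add (m n : ℤ) (p : UnitAddCircle × ℝ) :
    towerShift α φ (m + n) p = towerShift α φ m (towerShift α φ n p) := by
  rw [add_comm m n]
  ext
  · simp [towerShift, add_smul, add_assoc]
  · simp only [towerShift, rotationSum_add]; ring

/-- `towerShift` as an additive action. It is not an instance since it depends on `α` and `φ`. -/
abbrev towerAction (α : ℝ) (φ : UnitAddCircle → ℝ) : AddAction ℤ (UnitAddCircle × ℝ) where
  vadd := towerShift α φ
  zero_vadd := towerShift_zero
  add_vadd := towerShift_add

theorem towerShift_add_vertical (n : ℤ) (p : UnitAddCircle × ℝ) (t : ℝ) :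
    towerShift α φ n (p + (0, t)) = towerShift α φ n p + (0, t) := by
  ext <;> simp [towerShift]; ring

theorem specialFlow_eq_towerShift (t : ℝ) (p : UnitAddCircle × ℝ) :
    specialFlow α φ t p = towerShift α φ (specialIndex α φ t p) (p + (0, t)) := by
  simp [specialFlow, towerShift]

theorem measurable_towerShift (hφ : Continuous φ) (n : ℤ) : Measurable (towerShift α φ n) := by
  have := (continuous_rotationSum (α := α) hφ n)
  unfold towerShift
  fun_prop

theorem measurePreserving_towerShift (hφ : Continuous φ) (n : ℤ) :
    MeasurePreserving (towerShift α φ n) := by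
  refine MeasurePreserving.skew_product (f := fun x => x + n • (α : UnitAddCircle))
    (g := fun x s => s - rotationSum α φ n x) (measurePreserving_add_right _ _) ?_ ?_
  · exact (measurable_towerShift (α := α) hφ n).snd
  · exact ae_of_all _ fun x => (measurePreserving_sub_right volume (rotationSum α φ n x)).map_eq

theorem strictMono_rotationSum (hpos : ∀ x, 0 < φ x) (x : UnitAddCircle) :
    StrictMono fun n : ℤ => rotationSum α φ n x :=
  strictMono_int_of_lt_succ fun n => by
    simp only [rotationSum_add_one]
    linarith [hpos (x + n • (α : UnitAddCircle))]

theorem exists_pos_le_of_continuous (hφ : Continuous φ) (hpos : ∀ x, 0 < φ x) :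
    ∃ c : ℝ, 0 < c ∧ ∀ x, c ≤ φ x := by
  obtain ⟨x₀, -, hx₀⟩ := isCompact_univ.exists_isMinOn Set.univ_nonempty hφ.continuousOn
  exact ⟨φ x₀, hpos x₀, fun x => hx₀ (Set.mem_univ x)⟩

theorem exists_rotationSum_le_lt (hφ : Continuous φ) (hpos : ∀ x, 0 < φ x) (x : UnitAddCircle)
    (u : ℝ) : ∃ n : ℤ, rotationSum α φ n x ≤ u ∧ u < rotationSum α φ (n + 1) x := by
  obtain ⟨c, hc, hcφ⟩ := exists_pos_le_of_continuous hφ hpos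
  have mono_sub : Monotone fun n : ℤ => rotationSum α φ n x - c * n :=
    monotone_int_of_le_succ fun n => by
      simp only [rotationSum_add_one, Int.cast_add, Int.cast_one]
      linarith [hcφ (x + n • (α : UnitAddCircle))]
  have le_of_nonneg : ∀ n : ℤ, 0 ≤ n → c * n ≤ rotationSum α φ n x := fun n hn => by
    simpa [rotationSum_zero] using mono_sub hn
  have le_of_nonpos : ∀ n : ℤ, n ≤ 0 → rotationSum α φ n x ≤ c * n := fun n hn => by
    simpa [rotationSum_zero] using mono_sub hn
  obtain ⟨n, hn, hmax⟩ := Int.exists_greatest_of_bdd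
    (P := fun n : ℤ => rotationSum α φ n x ≤ u)
    ⟨max 0 ⌈u / c⌉, fun z hz => by
      rcases le_total z 0 with h0 | h0
      · exact h0.trans (le_max_left _ _)
      · have : (z : ℝ) ≤ u / c := (le_div_iff₀' hc).2 ((le_of_nonneg z h0).trans hz)
        exact (Int.cast_le.1 (this.trans (Int.le_ceil _))).trans (le_max_right _ _)⟩
    ⟨min 0 ⌊u / c⌋, (le_of_nonpos _ (min_le_left _ _)).trans <|
      (le_div_iff₀' hc).1 ((Int.cast_le.2 (min_le_right _ _)).trans (Int.floor_le _))⟩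
  exact ⟨n, hn, not_le.1 fun hle => (lt_add_one n).not_ge (hmax _ hle)⟩

theorem specialIndex_eq_iff (hφ : Continuous φ) (hpos : ∀ x, 0 < φ x) (t : ℝ)
    (p : UnitAddCircle × ℝ) (n : ℤ) : specialIndex α φ t p = n ↔
      rotationSum α φ n p.1 ≤ p.2 + t ∧ p.2 + t < rotationSum α φ (n + 1) p.1 := by
  have eq_of_le_lt : ∀ n : ℤ, rotationSum α φ n p.1 ≤ p.2 + t →
      p.2 + t < rotationSum α φ (n + 1) p.1 → specialIndex α φ t p = n := fun n hle hlt =>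
    IsGreatest.csSup_eq ⟨hle, fun m hm => Int.lt_add_one_iff.1 <|
      (strictMono_rotationSum (α := α) hpos p.1).lt_iff_lt.1 (lt_of_le_of_lt hm hlt)⟩
  constructor
  · rintro rfl
    obtain ⟨n, hle, hlt⟩ := exists_rotationSum_le_lt (α := α) hφ hpos p.1 (p.2 + t)
    rw [eq_of_le_lt n hle hlt]
    exact ⟨hle, hlt⟩
  · exact fun h => eq_of_le_lt n h.1 h.2

theorem specialIndex_eq_iff_mem (hφ : Continuous φ) (hpos : ∀ x, 0 < φ x) (t : ℝ)
    (p : UnitAddCircle × ℝ) (n : ℤ) :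
    specialIndex α φ t p = n ↔ towerShift α φ n (p + (0, t)) ∈ specialSpace φ := by
  rw [specialIndex_eq_iff hφ hpos]
  simp only [specialSpace, towerShift, Set.mem_ofPred_eq, rotationSum_add_one, Prod.fst_add,
    Prod.snd_add, add_zero, sub_nonneg, sub_lt_iff_lt_add']

theorem specialFlow_mem_specialSpace (hφ : Continuous φ) (hpos : ∀ x, 0 < φ x) (t : ℝ)
    (p : UnitAddCircle × ℝ) : specialFlow α φ t p ∈ specialSpace φ := by
  rw [specialFlow_eq_towerShift]
  exact (specialIndex_eq_iff_mem hφ hpos t p _).1 rfl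

theorem specialFlow_eq_of_mem (hφ : Continuous φ) (hpos : ∀ x, 0 < φ x) {t : ℝ}
    {p : UnitAddCircle × ℝ} {n : ℤ} (h : towerShift α φ n (p + (0, t)) ∈ specialSpace φ) :
    specialFlow α φ t p = towerShift α φ n (p + (0, t)) := by
  rw [specialFlow_eq_towerShift, (specialIndex_eq_iff_mem hφ hpos t p n).2 h]

theorem specialFlow_add (hφ : Continuous φ) (hpos : ∀ x, 0 < φ x) (s t : ℝ)
    (p : UnitAddCircle × ℝ) :
    specialFlow α φ (s + t) p = specialFlow α φ s (specialFlow α φ t p) := by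
  have flow_eq : specialFlow α φ s (specialFlow α φ t p) = towerShift α φ
      (specialIndex α φ s (specialFlow α φ t p) + specialIndex α φ t p) (p + (0, s + t)) := by
    rw [specialFlow_eq_towerShift s, specialFlow_eq_towerShift t, ← towerShift_add_vertical,
      ← towerShift_add, add_assoc]
    simp [add_comm t]
  rw [flow_eq]
  refine specialFlow_eq_of_mem hφ hpos ?_
  rw [← flow_eq]
  exact specialFlow_mem_specialSpace hφ hpos _ _

theorem specialFlow_towerShift (hφ : Continuous φ) (hpos : ∀ x, 0 < φ x) (t : ℝ) (n : ℤ)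
    (p : UnitAddCircle × ℝ) :
    specialFlow α φ t (towerShift α φ n p) = specialFlow α φ t p := by
  have flow_eq : specialFlow α φ t (towerShift α φ n p) = towerShift α φ
      (specialIndex α φ t (towerShift α φ n p) + n) (p + (0, t)) := by
    rw [specialFlow_eq_towerShift t, ← towerShift_add_vertical, ← towerShift_add]
  rw [flow_eq]
  refine (specialFlow_eq_of_mem hφ hpos ?_).symm
  rw [← flow_eq]
  exact specialFlow_mem_specialSpace hφ hpos _ _

theorem specialFlow_add_vertical (s t : ℝ) (p : UnitAddCircle × ℝ) :
    specialFlow α φ s (p + (0, t)) = specialFlow α φ (t + s) p := by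
  simp [specialFlow, specialIndex, add_assoc]

theorem specialFlow_of_mem (hφ : Continuous φ) (hpos : ∀ x, 0 < φ x) {t : ℝ}
    {p : UnitAddCircle × ℝ} (h : p + (0, t) ∈ specialSpace φ) :
    specialFlow α φ t p = p + (0, t) := by
  have := specialFlow_eq_of_mem (α := α) (n := 0) hφ hpos (t := t) (p := p)
    (by rwa [towerShift_zero])
  rwa [towerShift_zero] at this

theorem measurable_specialIndex (hφ : Continuous φ) (hpos : ∀ x, 0 < φ x) :
    Measurable fun z : ℝ × UnitAddCircle × ℝ => specialIndex α φ z.1 z.2 := by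
  refine measurable_to_countable' fun n => ?_
  have preimage_eq : (fun z : ℝ × UnitAddCircle × ℝ => specialIndex α φ z.1 z.2) ⁻¹' {n} =
      {z | rotationSum α φ n z.2.1 ≤ z.2.2 + z.1} ∩
        {z | z.2.2 + z.1 < rotationSum α φ (n + 1) z.2.1} := by
    ext z
    exact specialIndex_eq_iff hφ hpos z.1 z.2 n
  have := continuous_rotationSum (α := α) hφ n
  have := continuous_rotationSum (α := α) hφ (n + 1)
  rw [preimage_eq]
  exact (measurableSet_le (by fun_prop) (by fun_prop)).inter
    (measurableSet_lt (by fun_prop) (by fun_prop))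

theorem measurable_uncurry_specialFlow (hφ : Continuous φ) (hpos : ∀ x, 0 < φ x) :
    Measurable (Function.uncurry (specialFlow α φ)) := by
  have measurable_shift : Measurable fun w : (UnitAddCircle × ℝ) × ℤ => towerShift α φ w.2 w.1 :=
    measurable_from_prod_countable_left fun n => measurable_towerShift hφ n
  have uncurry_eq : Function.uncurry (specialFlow α φ) = fun z : ℝ × UnitAddCircle × ℝ =>
      towerShift α φ (specialIndex α φ z.1 z.2) (z.2 + (0, z.1)) :=
    funext fun z => specialFlow_eq_towerShift z.1 z.2
  rw [uncurry_eq]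
  exact measurable_shift.comp (.prodMk (by fun_prop) (measurable_specialIndex hφ hpos))

theorem measurable_specialFlow (hφ : Continuous φ) (hpos : ∀ x, 0 < φ x) (t : ℝ) :
    Measurable (specialFlow α φ t) :=
  (measurable_uncurry_specialFlow hφ hpos).of_uncurry_left

theorem measurableSet_specialSpace (hφ : Continuous φ) : MeasurableSet (specialSpace φ) :=
  (measurableSet_le measurable_const measurable_snd).inter
    (measurableSet_lt measurable_snd (hφ.measurable.comp measurable_fst))

theorem isAddFundamentalDomain_specialSpace (hφ : Continuous φ) (hpos : ∀ x, 0 < φ x) (t : ℝ) :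
    letI := towerAction α φ
    IsAddFundamentalDomain ℤ ((· + (0, t)) ⁻¹' specialSpace φ) := by
  let := towerAction α φ
  refine IsAddFundamentalDomain.mk'
    ((measurable_add_const _) (measurableSet_specialSpace hφ)).nullMeasurableSet fun p => ?_
  refine ⟨specialIndex α φ t p, ?_, fun n hn => ?_⟩
  · change towerShift α φ _ p + (0, t) ∈ specialSpace φ
    rw [← towerShift_add_vertical, ← specialFlow_eq_towerShift]
    exact specialFlow_mem_specialSpace hφ hpos t p
  · change towerShift α φ n p + (0, t) ∈ specialSpace φ at hn
    rw [← towerShift_add_vertical] at hn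
    exact ((specialIndex_eq_iff_mem hφ hpos t p n).2 hn).symm

/-- The set `T^{-t} B` is invariant under the tower action, hence has the same measure in the two
fundamental domains `specialSpace φ` and `specialSpace φ - (0, t)`. -/
theorem measurePreserving_specialFlow_restrict (hφ : Continuous φ) (hpos : ∀ x, 0 < φ x) (t : ℝ) :
    MeasurePreserving (specialFlow α φ t) (volume.restrict (specialSpace φ))
      (volume.restrict (specialSpace φ)) := by
  have hT := measurable_specialFlow (α := α) hφ hpos t
  refine ⟨hT, Measure.ext fun B hB => ?_⟩
  rw [Measure.map_apply hT hB, Measure.restrict_apply hB, Measure.restrict_apply (hT hB)]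
  let := towerAction α φ
  have : MeasurableConstVAdd ℤ (UnitAddCircle × ℝ) := ⟨measurable_towerShift hφ⟩
  have : VAddInvariantMeasure ℤ (UnitAddCircle × ℝ) volume :=
    ⟨fun n s hs => (measurePreserving_towerShift hφ n).measure_preimage hs.nullMeasurableSet⟩
  have vertical : MeasurePreserving (fun p : UnitAddCircle × ℝ => p + (0, t)) :=
    measurePreserving_add_right ((volume : Measure UnitAddCircle).prod (volume : Measure ℝ)) (0, t)
  have preimage_invariant : ∀ n : ℤ,
      (n +ᵥ ·) ⁻¹' (specialFlow α φ t ⁻¹' B) = specialFlow α φ t ⁻¹' B := fun n => by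
    ext p
    change specialFlow α φ t (towerShift α φ n p) ∈ B ↔ _
    rw [specialFlow_towerShift hφ hpos]
    rfl
  have phase_space_domain := isAddFundamentalDomain_specialSpace (α := α) hφ hpos 0
  simp only [← Prod.zero_eq_mk, add_zero, Set.preimage_id'] at phase_space_domain
  calc volume (specialFlow α φ t ⁻¹' B ∩ specialSpace φ)
      = volume (specialFlow α φ t ⁻¹' B ∩ (· + (0, t)) ⁻¹' specialSpace φ) :=
        phase_space_domain.measure_set_eq (isAddFundamentalDomain_specialSpace hφ hpos t)
          (hT hB) preimage_invariant
    _ = volume ((· + (0, t)) ⁻¹' (B ∩ specialSpace φ)) := by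
        congr 1
        ext p
        refine and_congr_left fun hp => ?_
        rw [Set.mem_preimage, specialFlow_of_mem hφ hpos hp]
    _ = volume (B ∩ specialSpace φ) := vertical.measure_preimage
        (hB.inter (measurableSet_specialSpace hφ)).nullMeasurableSet

theorem measurePreserving_specialFlow (hφ : Continuous φ) (hpos : ∀ x, 0 < φ x) (t : ℝ) :
    MeasurePreserving (specialFlow α φ t) (specialMeasure φ) (specialMeasure φ) :=
  (measurePreserving_specialFlow_restrict hφ hpos t).smul_measure _

theorem volume_specialSpace_pos (hφ : Continuous φ) (hpos : ∀ x, 0 < φ x) :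
    0 < volume (specialSpace φ) := by
  obtain ⟨c, hc, hcφ⟩ := exists_pos_le_of_continuous hφ hpos
  have hsub : (Set.univ : Set UnitAddCircle) ×ˢ Set.Ico 0 c ⊆ specialSpace φ :=
    fun p hp => ⟨hp.2.1, hp.2.2.trans_le (hcφ _)⟩
  refine lt_of_lt_of_le ?_ (measure_mono hsub)
  rw [Measure.volume_eq_prod, Measure.prod_prod]
  simp [hc]

theorem volume_specialSpace_lt_top (hφ : Continuous φ) : volume (specialSpace φ) < ⊤ := by
  obtain ⟨x₁, -, hx₁⟩ := isCompact_univ.exists_isMaxOn Set.univ_nonempty hφ.continuousOn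
  have hsub : specialSpace φ ⊆ (Set.univ : Set UnitAddCircle) ×ˢ Set.Icc 0 (φ x₁) :=
    fun p hp => ⟨Set.mem_univ _, hp.1, hp.2.le.trans (hx₁ (Set.mem_univ _))⟩
  refine lt_of_le_of_lt (measure_mono hsub) ?_
  rw [Measure.volume_eq_prod, Measure.prod_prod]
  simp

theorem isProbabilityMeasure_specialMeasure (hφ : Continuous φ) (hpos : ∀ x, 0 < φ x) :
    IsProbabilityMeasure (specialMeasure φ) :=
  cond_isProbabilityMeasure_of_finite (volume_specialSpace_pos hφ hpos).ne'
    (volume_specialSpace_lt_top hφ).ne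

end SpecialFlow

section WeakMixingCriterion

theorem sq_average_le_average_sq {r : ℝ → ℝ} {τ : ℝ} (hτ : 0 < τ)
    (hr : IntervalIntegrable r volume 0 τ)
    (hr2 : IntervalIntegrable (fun t => r t ^ 2) volume 0 τ) :
    (τ⁻¹ * ∫ t in (0 : ℝ)..τ, r t) ^ 2 ≤ τ⁻¹ * ∫ t in (0 : ℝ)..τ, r t ^ 2 := by
  set m := τ⁻¹ * ∫ t in (0 : ℝ)..τ, r t with hm
  have integral_eq : ∫ t in (0 : ℝ)..τ, r t = τ * m := by rw [hm, mul_inv_cancel_left₀ hτ.ne']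
  have variance_nonneg : 0 ≤ ∫ t in (0 : ℝ)..τ, (r t ^ 2 - 2 * m * r t + m ^ 2) :=
    intervalIntegral.integral_nonneg hτ.le fun t _ => by linarith [sq_nonneg (r t - m)]
  rw [intervalIntegral.integral_add (hr2.sub (hr.const_mul _)) intervalIntegrable_const,
    intervalIntegral.integral_sub hr2 (hr.const_mul _), intervalIntegral.integral_const_mul,
    integral_eq, intervalIntegral.integral_const, smul_eq_mul] at variance_nonneg
  rw [le_inv_mul_iff₀ hτ]
  linarith

theorem tendsto_average_abs_of_sq {r : ℝ → ℝ} {C : ℝ} (hr : Measurable r) (hC : ∀ t, |r t| ≤ C)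
    (h : Tendsto (fun τ : ℝ => τ⁻¹ * ∫ t in (0 : ℝ)..τ, r t ^ 2) atTop (𝓝 0)) :
    Tendsto (fun τ : ℝ => τ⁻¹ * ∫ t in (0 : ℝ)..τ, |r t|) atTop (𝓝 0) := by
  have integrable_abs : ∀ τ, IntervalIntegrable (fun t => |r t|) volume 0 τ := fun τ =>
    (intervalIntegrable_const (c := C)).mono_fun hr.abs.aestronglyMeasurable
      (ae_of_all _ fun t => by simpa using (hC t).trans (le_abs_self C))
  have integrable_sq : ∀ τ, IntervalIntegrable (fun t => |r t| ^ 2) volume 0 τ := fun τ =>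
    (intervalIntegrable_const (c := C ^ 2)).mono_fun (hr.abs.pow_const 2).aestronglyMeasurable
      (ae_of_all _ fun t => by simpa using sq_le_sq.2 ((hC t).trans (le_abs_self C)))
  have sqrt_tendsto := h.sqrt
  rw [Real.sqrt_zero] at sqrt_tendsto
  refine squeeze_zero' ?_ ?_ sqrt_tendsto
  · filter_upwards [eventually_ge_atTop 0] with τ hτ
    exact mul_nonneg (inv_nonneg.2 hτ)
      (intervalIntegral.integral_nonneg hτ fun t _ => abs_nonneg _)
  · filter_upwards [eventually_gt_atTop 0] with τ hτ
    refine Real.le_sqrt_of_sq_le ?_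
    simpa only [sq_abs] using
      sq_average_le_average_sq hτ (integrable_abs τ) (integrable_sq τ)

theorem exists_frequency_of_joint_eigenvector {H : Type*} [NormedAddCommGroup H]
    [InnerProductSpace ℂ H] {U : ℝ → H →ₗᵢ[ℂ] H} (hadd : ∀ s t x, U (s + t) x = U s (U t x))
    {h : H} (hh : h ≠ 0) (hmeas : Measurable fun t => ⟪h, U t h⟫_ℂ) {χ : ℝ → ℂ}
    (hχ : ∀ t, U t h = χ t • h) : ∃ ν : ℝ, ∀ t, χ t = Complex.exp (ν * t * Complex.I) := by
  refine exists_eq_cexp_of_measurable_character ?_ (fun s t => ?_) fun t => ?_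
  · have χ_eq : χ = fun t => ⟪h, U t h⟫_ℂ / ⟪h, h⟫_ℂ := by
      funext t
      rw [hχ, inner_smul_right, mul_div_cancel_right₀ _ (inner_self_ne_zero.2 hh)]
    exact χ_eq ▸ hmeas.div_const _
  · refine smul_left_injective ℂ hh ?_
    beta_reduce
    rw [← hχ, hadd, hχ t, map_smul, hχ s, smul_smul, mul_comm]
  · refine mul_right_cancel₀ (norm_ne_zero_iff.2 hh) ?_
    rw [one_mul, ← norm_smul, ← hχ, (U t).norm_map]

variable {X : Type*} [MeasurableSpace X] {μ : Measure X} {T : ℝ → X → X}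

/-- The Koopman operators `f ↦ f ∘ T t` on `L²` of a measure preserving flow. -/
noncomputable def koopman (hT : ∀ t, MeasurePreserving (T t) μ μ) (t : ℝ) :
    Lp ℂ 2 μ →ₗᵢ[ℂ] Lp ℂ 2 μ :=
  Lp.compMeasurePreservingₗᵢ ℂ (T t) (hT t)

theorem coeFn_koopman (hT : ∀ t, MeasurePreserving (T t) μ μ) (t : ℝ) (f : Lp ℂ 2 μ) :
    koopman hT t f =ᵐ[μ] f ∘ T t :=
  Lp.coeFn_compMeasurePreserving f (hT t)

theorem koopman_add (hT : ∀ t, MeasurePreserving (T t) μ μ)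
    (hadd : ∀ s t x, T (s + t) x = T s (T t x)) (s t : ℝ) (f : Lp ℂ 2 μ) :
    koopman hT (s + t) f = koopman hT s (koopman hT t f) := by
  refine Lp.ext ?_
  filter_upwards [coeFn_koopman hT (s + t) f, coeFn_koopman hT s (koopman hT t f),
    (hT s).quasiMeasurePreserving.ae (coeFn_koopman hT t f)] with x h_sum h_outer h_inner
  rw [h_sum, h_outer, Function.comp_apply, Function.comp_apply, h_inner, Function.comp_apply,
    add_comm, hadd]

theorem measurable_inner_koopman [SFinite μ] (hT : ∀ t, MeasurePreserving (T t) μ μ)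
    (hjoint : Measurable (Function.uncurry T)) (f g : Lp ℂ 2 μ) :
    Measurable fun t => ⟪g, koopman hT t f⟫_ℂ := by
  have inner_eq : ∀ t, ⟪g, koopman hT t f⟫_ℂ = ∫ x, f (T t x) * starRingEnd ℂ (g x) ∂μ := by
    intro t
    rw [L2.inner_def]
    refine integral_congr_ae ?_
    filter_upwards [coeFn_koopman hT t f] with x hx
    rw [hx]
    rfl
  simp_rw [inner_eq]
  have hf : StronglyMeasurable fun z : ℝ × X => f (T z.1 z.2) :=
    (Lp.stronglyMeasurable f).comp_measurable hjoint
  have hg : StronglyMeasurable fun z : ℝ × X => starRingEnd ℂ (g z.2) :=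
    Complex.continuous_conj.comp_stronglyMeasurable
      ((Lp.stronglyMeasurable g).comp_measurable measurable_snd)
  exact (StronglyMeasurable.integral_prod_right (hf.mul hg)).measurable

variable [IsProbabilityMeasure μ]

/-- The indicator of `B` minus its mean. -/
noncomputable def centeredIndicator (μ : Measure X) [IsProbabilityMeasure μ] {B : Set X}
    (hB : MeasurableSet B) : Lp ℂ 2 μ :=
  indicatorConstLp 2 hB (measure_ne_top μ B) 1 -
    (μ.real B : ℂ) • indicatorConstLp 2 MeasurableSet.univ (measure_ne_top μ Set.univ) 1

theorem inner_koopman_centeredIndicator (hT : ∀ t, MeasurePreserving (T t) μ μ) {A B : Set X}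
    (hA : MeasurableSet A) (hB : MeasurableSet B) (t : ℝ) :
    ⟪indicatorConstLp 2 hA (measure_ne_top μ A) (1 : ℂ), koopman hT t (centeredIndicator μ hB)⟫_ℂ =
      ((μ.real (A ∩ T t ⁻¹' B) - μ.real A * μ.real B : ℝ) : ℂ) := by
  have koopman_indicator : ∀ {S : Set X} (hS : MeasurableSet S),
      koopman hT t (indicatorConstLp 2 hS (measure_ne_top μ S) 1) =
        indicatorConstLp 2 (hS.preimage (hT t).measurable) (measure_ne_top μ _) 1 := fun hS =>
    Lp.indicatorConstLp_compMeasurePreserving hS (measure_ne_top μ _) 1 (hT t)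
  rw [centeredIndicator, map_sub, map_smul, koopman_indicator, koopman_indicator, inner_sub_right,
    inner_smul_right, L2.inner_indicatorConstLp_one_indicatorConstLp_one,
    L2.inner_indicatorConstLp_one_indicatorConstLp_one, Set.preimage_univ, Set.inter_univ]
  simp [mul_comm]

theorem isWeakMixingFlow_of_eigenfunction_ae_eq_zero (hT : ∀ t, MeasurePreserving (T t) μ μ)
    (hjoint : Measurable (Function.uncurry T)) (hadd : ∀ s t x, T (s + t) x = T s (T t x))
    (hno : ∀ (h : X → ℂ) (ν : ℝ), Measurable h →
      (∀ t, ∀ᵐ x ∂μ, h (T t x) = Complex.exp (ν * t * Complex.I) * h x) →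
      ∫ x, h x ∂μ = 0 → h =ᵐ[μ] 0) :
    IsWeakMixingFlow μ T := by
  refine ⟨hT, fun A B hA hB => ?_⟩
  have hcorr := inner_koopman_centeredIndicator hT hA hB
  have hmeas := measurable_inner_koopman hT hjoint
  have measurable_corr : Measurable fun t => μ.real (A ∩ T t ⁻¹' B) - μ.real A * μ.real B := by
    simpa only [hcorr, Function.comp_def, Complex.ofReal_re] using Complex.measurable_re.comp
      (hmeas (centeredIndicator μ hB) (indicatorConstLp 2 hA (measure_ne_top μ A) 1))
  refine tendsto_average_abs_of_sq measurable_corr (fun t => abs_sub_le_of_nonneg_of_le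
    measureReal_nonneg measureReal_le_one (by positivity)
    (mul_le_one₀ measureReal_le_one measureReal_nonneg measureReal_le_one)) ?_
  by_contra hnot
  obtain ⟨h, χ, hh, hχ, horth⟩ := exists_joint_eigenvector_of_not_tendsto (koopman_add hT hadd)
    hmeas (f := centeredIndicator μ hB) (g := indicatorConstLp 2 hA (measure_ne_top μ A) 1)
    (by simpa only [hcorr, Complex.norm_real, Real.norm_eq_abs, sq_abs] using hnot)
  obtain ⟨ν, hν⟩ :=
    exists_frequency_of_joint_eigenvector (koopman_add hT hadd) hh (hmeas h h) hχ
  suffices h_zero : h =ᵐ[μ] 0 from hh ((Lp.eq_zero_iff_ae_eq_zero).2 h_zero)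
  refine hno h ν (Lp.stronglyMeasurable h).measurable (fun t => ?_) ?_
  · filter_upwards [coeFn_koopman hT t h, Lp.coeFn_smul (χ t) h] with x h_comp h_smul
    rw [hχ, h_smul, Pi.smul_apply, smul_eq_mul, hν] at h_comp
    exact h_comp.symm
  · have mean_orth := inner_eq_zero_symm.1 <|
      horth (indicatorConstLp 2 MeasurableSet.univ (measure_ne_top μ _) 1) fun t => by
        rw [inner_eq_zero_symm, inner_koopman_centeredIndicator]
        simp [(hT t).measureReal_preimage hB.nullMeasurableSet]
    rwa [L2.inner_indicatorConstLp_one, setIntegral_univ] at mean_orth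

end WeakMixingCriterion

section SpecialFlowEigenfunctions

variable {α : ℝ} {φ : UnitAddCircle → ℝ}

theorem ergodic_rotation (hα : Irrational α) :
    Ergodic fun x : UnitAddCircle => x + (α : UnitAddCircle) := by
  rw [AddCircle.ergodic_add_right, ← AddCircle.denseRange_zsmul_iff,
    AddCircle.denseRange_zsmul_coe_iff]
  simpa using hα

theorem ae_specialMeasure_iff (hφ : Continuous φ) {P : UnitAddCircle × ℝ → Prop} :
    (∀ᵐ p ∂specialMeasure φ, P p) ↔ ∀ᵐ p, p ∈ specialSpace φ → P p := by
  rw [specialMeasure, ProbabilityTheory.cond, Measure.ae_ennreal_smul_measure_iff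
    (ENNReal.inv_ne_zero.2 (volume_specialSpace_lt_top hφ).ne),
    ae_restrict_iff' (measurableSet_specialSpace hφ)]

theorem exists_mul_cexp_on_fibre (hφ : Continuous φ) (hpos : ∀ x, 0 < φ x)
    {h : UnitAddCircle × ℝ → ℂ} (hm : Measurable h) {ν : ℝ}
    (heig : ∀ t, ∀ᵐ p ∂specialMeasure φ,
      h (specialFlow α φ t p) = Complex.exp (ν * t * Complex.I) * h p) :
    ∀ᵐ x, ∃ w : ℂ, ∀ᵐ u : ℝ,
      h (specialFlow α φ u (x, 0)) = Complex.exp (ν * u * Complex.I) * w := by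
  have eig_ae_time : ∀ᵐ p ∂specialMeasure φ, ∀ᵐ t : ℝ,
      h (specialFlow α φ t p) = Complex.exp (ν * t * Complex.I) * h p := by
    have := isProbabilityMeasure_specialMeasure hφ hpos
    rw [← Measure.ae_ae_comm (p := fun t p =>
      h (specialFlow α φ t p) = Complex.exp (ν * t * Complex.I) * h p)]
    · exact ae_of_all _ heig
    · exact measurableSet_eq_fun (hm.comp (measurable_uncurry_specialFlow hφ hpos))
        (Measurable.mul (by fun_prop) (hm.comp measurable_snd))
  filter_upwards [Measure.ae_ae_of_ae_prod ((ae_specialMeasure_iff hφ).1 eig_ae_time)] with x hx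
  obtain ⟨s, hs, hsx⟩ : ∃ s, s ∈ Set.Ico 0 (φ x) ∧ ((x, s) ∈ specialSpace φ → ∀ᵐ t : ℝ,
      h (specialFlow α φ t (x, s)) = Complex.exp (ν * t * Complex.I) * h (x, s)) := by
    by_contra hcon
    have fibre_null : volume (Set.Ico 0 (φ x)) = 0 := measure_eq_zero_iff_ae_notMem.2
      (hx.mono fun s hs hmem => hcon ⟨s, hmem, hs⟩)
    simp [(hpos x).not_ge] at fibre_null
  refine ⟨Complex.exp (-(ν * s * Complex.I)) * h (x, s), ?_⟩
  filter_upwards [(measurePreserving_sub_right volume s).quasiMeasurePreserving.ae (hsx hs)]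
    with u hu
  have flow_eq : specialFlow α φ (u - s) (x, s) = specialFlow α φ u (x, 0) := by
    simpa using specialFlow_add_vertical (α := α) (φ := φ) (u - s) s (x, 0)
  rw [← flow_eq, hu, ← mul_assoc, ← Complex.exp_add]
  congr 2
  push_cast
  ring

theorem exists_eigenfunction_base (hφ : Continuous φ) (hpos : ∀ x, 0 < φ x)
    {h : UnitAddCircle × ℝ → ℂ} (hm : Measurable h) {ν : ℝ}
    (heig : ∀ t, ∀ᵐ p ∂specialMeasure φ,
      h (specialFlow α φ t p) = Complex.exp (ν * t * Complex.I) * h p) :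
    ∃ ψ : UnitAddCircle → ℂ, Measurable ψ ∧ ∀ᵐ x, ∀ᵐ u : ℝ,
      h (specialFlow α φ u (x, 0)) = Complex.exp (ν * u * Complex.I) * ψ x := by
  -- averaging over `u ∈ (0, 1]` selects the fibre constant measurably
  refine ⟨fun x => ∫ u in Set.Ioc (0 : ℝ) 1,
    Complex.exp (-(ν * u * Complex.I)) * h (specialFlow α φ u (x, 0)), ?_, ?_⟩
  · have measurable_flow :
        Measurable fun z : UnitAddCircle × ℝ => specialFlow α φ z.2 (z.1, 0) := by
      have measurable_initial : Measurable fun z : UnitAddCircle × ℝ => (z.2, z.1, (0 : ℝ)) := by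
        fun_prop
      have := (measurable_uncurry_specialFlow (α := α) hφ hpos).comp measurable_initial
      rwa [Function.comp_def] at this
    have measurable_integrand : Measurable fun z : UnitAddCircle × ℝ =>
        Complex.exp (-(ν * z.2 * Complex.I)) * h (specialFlow α φ z.2 (z.1, 0)) :=
      Measurable.mul (by fun_prop) (hm.comp measurable_flow)
    exact (StronglyMeasurable.integral_prod_right
      measurable_integrand.stronglyMeasurable).measurable
  · filter_upwards [exists_mul_cexp_on_fibre hφ hpos hm heig] with x ⟨w, hw⟩
    have integrand_eq : ∀ᵐ u : ℝ,
        Complex.exp (-(ν * u * Complex.I)) * h (specialFlow α φ u (x, 0)) = w := by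
      filter_upwards [hw] with u hu
      rw [hu, ← mul_assoc, ← Complex.exp_add, neg_add_cancel, Complex.exp_zero, one_mul]
    rw [integral_congr_ae (ae_restrict_of_ae integrand_eq)]
    simpa using hw

theorem cocycle_of_eigenfunction_base (hφ : Continuous φ) (hpos : ∀ x, 0 < φ x)
    {h : UnitAddCircle × ℝ → ℂ} {ν : ℝ} {ψ : UnitAddCircle → ℂ}
    (hψ : ∀ᵐ x, ∀ᵐ u : ℝ,
      h (specialFlow α φ u (x, 0)) = Complex.exp (ν * u * Complex.I) * ψ x) :
    ∀ᵐ x, ψ (x + (α : UnitAddCircle)) = Complex.exp (ν * φ x * Complex.I) * ψ x := by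
  filter_upwards [hψ, (measurePreserving_add_right volume
    (α : UnitAddCircle)).quasiMeasurePreserving.ae hψ] with x hx hxα
  obtain ⟨u, hu, hφu⟩ := (hxα.and
    ((measurePreserving_add_left volume (φ x)).quasiMeasurePreserving.ae hx)).exists
  have crossing : towerShift α φ 1 ((x, 0) + (0, φ x)) = (x + (α : UnitAddCircle), 0) := by
    have : rotationSum α φ 1 x = φ x := by
      simpa [rotationSum_zero] using rotationSum_add_one (α := α) (φ := φ) 0 x
    simp [towerShift, this]
  have exp_add : Complex.exp (ν * (φ x + u : ℝ) * Complex.I) =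
      Complex.exp (ν * u * Complex.I) * Complex.exp (ν * φ x * Complex.I) := by
    rw [← Complex.exp_add]
    congr 1
    push_cast
    ring
  rw [← crossing, specialFlow_towerShift hφ hpos, specialFlow_add_vertical, hφu, exp_add,
    mul_assoc] at hu
  exact (mul_left_cancel₀ (Complex.exp_ne_zero _) hu).symm

theorem eigenfunction_ae_eq_base (hφ : Continuous φ) (hpos : ∀ x, 0 < φ x)
    {h : UnitAddCircle × ℝ → ℂ} (hm : Measurable h) {ν : ℝ} {ψ : UnitAddCircle → ℂ}
    (hψm : Measurable ψ) (hψ : ∀ᵐ x, ∀ᵐ u : ℝ,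
      h (specialFlow α φ u (x, 0)) = Complex.exp (ν * u * Complex.I) * ψ x) :
    ∀ᵐ p ∂specialMeasure φ, h p = Complex.exp (ν * p.2 * Complex.I) * ψ p.1 := by
  rw [ae_specialMeasure_iff hφ]
  refine (Measure.ae_prod_iff_ae_ae (μ := (volume : Measure UnitAddCircle))
    (ν := (volume : Measure ℝ)) ?_).2 ?_
  · have measurableSet_eq : MeasurableSet {p : UnitAddCircle × ℝ |
        h p = Complex.exp (ν * p.2 * Complex.I) * ψ p.1} :=
      measurableSet_eq_fun hm (Measurable.mul (by fun_prop) (hψm.comp measurable_fst))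
    exact (measurableSet_specialSpace hφ).imp measurableSet_eq
  · filter_upwards [hψ] with x hx
    filter_upwards [hx] with u hu hmem
    rw [specialFlow_of_mem hφ hpos (by simpa using hmem)] at hu
    simpa using hu

theorem ae_eq_zero_or_norm_eq_one_of_cocycle (hα : Irrational α) {ν : ℝ} {ψ : UnitAddCircle → ℂ}
    (hψm : Measurable ψ)
    (hψ : ∀ᵐ x, ψ (x + (α : UnitAddCircle)) = Complex.exp (ν * φ x * Complex.I) * ψ x) :
    (∀ᵐ x, ψ x = 0) ∨ ∃ c : ℂ, ∀ᵐ x, ‖c * ψ x‖ = 1 := by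
  obtain ⟨r, hr⟩ := (ergodic_rotation hα).ae_eq_const_of_ae_eq_comp_ae (g := fun x => ‖ψ x‖)
    hψm.norm.aestronglyMeasurable (by
      filter_upwards [hψ] with x hx
      rw [Function.comp_apply, hx, norm_mul, ← Complex.ofReal_mul,
        Complex.norm_exp_ofReal_mul_I, one_mul])
  rcases eq_or_ne r 0 with rfl | hr0
  · exact Or.inl (hr.mono fun x hx => norm_eq_zero.1 hx)
  · refine Or.inr ⟨(r : ℂ)⁻¹, hr.mono fun x hx => ?_⟩
    have norm_eq : ‖ψ x‖ = r := hx
    rw [norm_mul, norm_inv, Complex.norm_real, ← norm_eq, norm_norm, norm_eq, inv_mul_cancel₀ hr0]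

theorem isWeakMixingFlow_specialFlow (hφ : Continuous φ) (hpos : ∀ x, 0 < φ x)
    (hα : Irrational α)
    (hno : ∀ (ν : ℝ) (ψ : UnitAddCircle → ℂ), ν ≠ 0 → Measurable ψ → (∀ᵐ x, ‖ψ x‖ = 1) →
      ¬ ∀ᵐ x, ψ (x + (α : UnitAddCircle)) = Complex.exp (ν * φ x * Complex.I) * ψ x) :
    IsWeakMixingFlow (specialMeasure φ) (specialFlow α φ) := by
  have := isProbabilityMeasure_specialMeasure hφ hpos
  refine isWeakMixingFlow_of_eigenfunction_ae_eq_zero (measurePreserving_specialFlow hφ hpos)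
    (measurable_uncurry_specialFlow hφ hpos) (specialFlow_add hφ hpos) fun h ν hm heig hmean => ?_
  obtain ⟨ψ, hψm, hψ⟩ := exists_eigenfunction_base hφ hpos hm heig
  have hcocycle := cocycle_of_eigenfunction_base hφ hpos hψ
  have h_eq := eigenfunction_ae_eq_base hφ hpos hm hψm hψ
  have ae_fst : ∀ {P : UnitAddCircle → Prop}, (∀ᵐ x, P x) → ∀ᵐ p ∂specialMeasure φ, P p.1 :=
    fun hP => cond_absolutelyContinuous.ae_le (Measure.quasiMeasurePreserving_fst.ae hP)
  rcases ae_eq_zero_or_norm_eq_one_of_cocycle hα hψm hcocycle with hψ0 | ⟨c, hc⟩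
  · filter_upwards [h_eq, ae_fst hψ0] with p hp hp0
    rw [hp, hp0, mul_zero, Pi.zero_apply]
  rcases eq_or_ne ν 0 with rfl | hν
  · obtain ⟨w, hw⟩ := (ergodic_rotation hα).ae_eq_const_of_ae_eq_comp_ae
      hψm.aestronglyMeasurable (hcocycle.mono fun x hx => by simpa using hx)
    have h_const : h =ᵐ[specialMeasure φ] fun _ => w := by
      filter_upwards [h_eq, ae_fst hw] with p hp hpw
      simp [hp, hpw]
    rw [integral_congr_ae h_const, integral_const, probReal_univ, one_smul] at hmean
    rwa [hmean] at h_const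
  · exact absurd (hcocycle.mono fun x hx => by rw [hx, mul_left_comm])
      (hno ν (fun x => c * ψ x) hν (hψm.const_mul _) hc)

end SpecialFlowEigenfunctions

section RationalApproximation

/-- The denominators `q` of the reduced fractions `p / q` with `|q α - p| < 1 / (2 q ^ 2)`. Each of
them is the denominator of a convergent of `α`, and `m ≥ 1` satisfies `‖m α‖ < 1 / (2 m ^ 2)` only
if it is a multiple of one of them. -/
def goodDenominators (α : ℝ) : Set ℕ :=
  {q | 1 ≤ q ∧ ∃ p : ℤ, IsCoprime p (q : ℤ) ∧ |(q : ℝ) * α - p| < 1 / (2 * (q : ℝ) ^ 2)}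

theorem nsmul_coe_unitAddCircle (m : ℕ) (α : ℝ) :
    m • (α : UnitAddCircle) = (((m : ℝ) * α : ℝ) : UnitAddCircle) := by
  rw [← AddCircle.coe_nsmul, nsmul_eq_mul]

theorem zsmul_coe_unitAddCircle (m : ℤ) (α : ℝ) :
    m • (α : UnitAddCircle) = (((m : ℝ) * α : ℝ) : UnitAddCircle) := by
  rw [← AddCircle.coe_zsmul, zsmul_eq_mul]

theorem norm_coe_unitAddCircle_eq_abs_sub {x : ℝ} {p : ℤ} (h : |x - p| < 1 / 2) :
    ‖(x : UnitAddCircle)‖ = |x - p| := by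
  have hround : round x = p := by
    rw [abs_lt] at h
    rw [round_eq, Int.floor_eq_iff]
    constructor <;> linarith
  rw [UnitAddCircle.norm_eq, hround]

theorem norm_zsmul_pos {α : ℝ} (hα : Irrational α) {m : ℤ} (hm : m ≠ 0) :
    0 < ‖m • (α : UnitAddCircle)‖ := by
  rw [zsmul_coe_unitAddCircle, UnitAddCircle.norm_eq, abs_pos, sub_ne_zero]
  exact (hα.intCast_mul hm).ne_int _

variable {α : ℝ}

theorem norm_nsmul_eq_of_abs_sub_lt {q : ℕ} (hq : 1 ≤ q) {p : ℤ}
    (h : |(q : ℝ) * α - p| < 1 / (2 * (q : ℝ) ^ 2)) :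
    ‖q • (α : UnitAddCircle)‖ = |(q : ℝ) * α - p| := by
  rw [nsmul_coe_unitAddCircle]
  have hq1 : (1 : ℝ) ≤ (q : ℝ) ^ 2 := one_le_pow₀ (by exact_mod_cast hq)
  exact norm_coe_unitAddCircle_eq_abs_sub (h.trans_le (by gcongr; linarith))

theorem norm_nsmul_lt_of_mem_goodDenominators {q : ℕ} (hq : q ∈ goodDenominators α) :
    ‖q • (α : UnitAddCircle)‖ < 1 / (2 * (q : ℝ) ^ 2) := by
  obtain ⟨hq1, p, -, hlt⟩ := hq
  rwa [norm_nsmul_eq_of_abs_sub_lt hq1 hlt]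

theorem one_le_abs_mul_sub_mul {p p' : ℤ} {q q' : ℕ} (hp : IsCoprime p (q : ℤ))
    (hp' : IsCoprime p' (q' : ℤ)) (hne : q ≠ q') : (1 : ℝ) ≤ |(p : ℝ) * q' - p' * q| := by
  have hdet : p * q' - p' * q ≠ 0 := by
    refine fun h0 => hne ?_
    have heq : p * q' = p' * q := sub_eq_zero.1 h0
    have hdvd : (q : ℤ) ∣ q' := hp.symm.dvd_of_dvd_mul_left (Dvd.intro_left p' heq.symm)
    have hdvd' : (q' : ℤ) ∣ q := hp'.symm.dvd_of_dvd_mul_left (Dvd.intro_left p heq)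
    exact Nat.dvd_antisymm (Int.natCast_dvd_natCast.1 hdvd) (Int.natCast_dvd_natCast.1 hdvd')
  exact_mod_cast Int.one_le_abs hdet

theorem half_le_mul_norm_nsmul {q q' : ℕ} (hq : q ∈ goodDenominators α)
    (hq' : q' ∈ goodDenominators α) (hlt : q < q') :
    1 / 2 ≤ q' * ‖q • (α : UnitAddCircle)‖ := by
  obtain ⟨hq1, p, hp, hb⟩ := hq
  obtain ⟨-, p', hp', hb'⟩ := hq'
  rw [norm_nsmul_eq_of_abs_sub_lt hq1 hb]
  have hlt' : (q : ℝ) < q' := by exact_mod_cast hlt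
  have hq'1 : (1 : ℝ) ≤ q' := by exact_mod_cast hq1.trans hlt.le
  have hsmall : q * |(q' : ℝ) * α - p'| ≤ 1 / 2 :=
    calc q * |(q' : ℝ) * α - p'| ≤ q' * (1 / (2 * (q' : ℝ) ^ 2)) := by gcongr
      _ = 1 / (2 * q') := by field_simp
      _ ≤ 1 / 2 := by gcongr; linarith
  have htri : (1 : ℝ) ≤ q' * |(q : ℝ) * α - p| + q * |(q' : ℝ) * α - p'| :=
    calc (1 : ℝ) ≤ |(p : ℝ) * q' - p' * q| := one_le_abs_mul_sub_mul hp hp' hlt.ne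
      _ = |q * (q' * α - p') - q' * (q * α - p)| := by ring_nf
      _ ≤ |q * (q' * α - p')| + |q' * (q * α - p)| := abs_sub _ _
      _ = q' * |(q : ℝ) * α - p| + q * |(q' : ℝ) * α - p'| := by
        rw [abs_mul, abs_mul, Nat.abs_cast, Nat.abs_cast, add_comm]
  linarith

theorem sq_le_of_lt_of_mem_goodDenominators {q q' : ℕ} (hq : q ∈ goodDenominators α)
    (hq' : q' ∈ goodDenominators α) (hlt : q < q') : q ^ 2 ≤ q' := by
  have hhalf := half_le_mul_norm_nsmul hq hq' hlt
  have hq0 : (0 : ℝ) < q := by exact_mod_cast hq.1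
  have h : (1 : ℝ) / 2 ≤ q' * (1 / (2 * (q : ℝ) ^ 2)) :=
    hhalf.trans (by gcongr; exact (norm_nsmul_lt_of_mem_goodDenominators hq).le)
  have h' : (q : ℝ) ^ 2 ≤ q' := by
    rw [← mul_div_assoc, mul_one, div_le_div_iff₀ two_pos (by positivity)] at h
    linarith
  exact_mod_cast h'

theorem exists_reduced_fraction {m : ℕ} (hm : 1 ≤ m) (p : ℤ) :
    ∃ (l q : ℕ) (p₀ : ℤ), 1 ≤ l ∧ 1 ≤ q ∧ IsCoprime p₀ (q : ℤ) ∧ m = l * q ∧ p = l * p₀ := by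
  obtain ⟨l, p₀, q, hl, hcop, hp, hq⟩ :=
    Int.exists_gcd_one' (Int.gcd_pos_of_ne_zero_right p (by omega : (m : ℤ) ≠ 0))
  have hq0 : 0 < q := pos_of_mul_pos_left (hq ▸ by omega : 0 < q * l) (by positivity)
  lift q to ℕ using hq0.le
  refine ⟨l, q, p₀, hl, by omega, Int.isCoprime_iff_gcd_eq_one.2 hcop, ?_, by rw [hp, mul_comm]⟩
  rw [mul_comm]
  exact_mod_cast hq

theorem exists_goodDenominator_of_lt {m : ℕ} (hm : 1 ≤ m)
    (h : ‖m • (α : UnitAddCircle)‖ < 1 / (2 * (m : ℝ) ^ 2)) :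
    ∃ q ∈ goodDenominators α, ∃ l : ℕ, 1 ≤ l ∧ m = l * q ∧
      ‖m • (α : UnitAddCircle)‖ = l * ‖q • (α : UnitAddCircle)‖ := by
  rw [nsmul_coe_unitAddCircle, UnitAddCircle.norm_eq] at h ⊢
  obtain ⟨l, q, p, hl, hq, hcop, rfl, hp⟩ := exists_reduced_fraction hm (round ((m : ℝ) * α))
  have hscale :
      |((l * q : ℕ) : ℝ) * α - round (((l * q : ℕ) : ℝ) * α)| = l * |(q : ℝ) * α - p| := by
    rw [hp]
    push_cast
    rw [mul_assoc, ← mul_sub, abs_mul, Nat.abs_cast]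
  rw [hscale] at h ⊢
  have hl1 : (1 : ℝ) ≤ l := by exact_mod_cast hl
  have hq0 : (0 : ℝ) < q := by exact_mod_cast hq
  have hlt : |(q : ℝ) * α - p| < 1 / (2 * (q : ℝ) ^ 2) :=
    calc |(q : ℝ) * α - p| ≤ l * |(q : ℝ) * α - p| := le_mul_of_one_le_left (abs_nonneg _) hl1
      _ < 1 / (2 * ((l * q : ℕ) : ℝ) ^ 2) := h
      _ ≤ 1 / (2 * (q : ℝ) ^ 2) := by
        push_cast
        gcongr
        exact le_mul_of_one_le_left hq0.le hl1
  exact ⟨q, ⟨hq, p, hcop, hlt⟩, l, hl, rfl, by rw [norm_nsmul_eq_of_abs_sub_lt hq hlt]⟩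

end RationalApproximation

section FourierDecay

theorem norm_fourierCoeffOn_le_deriv {f f' : ℝ → ℂ} (hf : ∀ x, HasDerivAt f (f' x) x)
    (hf' : Continuous f') (hper : f 1 = f 0) {n : ℤ} (hn : n ≠ 0) :
    ‖fourierCoeffOn zero_lt_one f n‖ ≤ ‖fourierCoeffOn zero_lt_one f' n‖ / |(n : ℝ)| := by
  have hn0 : (0 : ℝ) < |(n : ℝ)| := abs_pos.2 (by exact_mod_cast hn)
  rw [fourierCoeffOn_of_hasDerivAt zero_lt_one hn (fun x _ => hf x)
    (hf'.intervalIntegrable _ _), hper]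
  simp only [sub_self, mul_zero, zero_sub, norm_mul, norm_div, norm_neg, norm_one,
    Complex.ofReal_one, Complex.ofReal_zero, sub_zero, one_mul, Complex.norm_I, mul_one,
    Complex.norm_intCast, Complex.norm_ofNat, Complex.norm_real,
    Real.norm_of_nonneg Real.pi_pos.le]
  rw [div_mul_eq_mul_div, one_mul]
  gcongr
  nlinarith [Real.pi_gt_three]

theorem norm_fourierCoeffOn_le_of_contDiff (k : ℕ) {f : ℝ → ℂ} (hf : ContDiff ℝ k f)
    (hper : Function.Periodic f 1) :
    ∃ K : ℝ, ∀ n : ℤ, n ≠ 0 → ‖fourierCoeffOn zero_lt_one f n‖ ≤ K / |(n : ℝ)| ^ k := by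
  induction k generalizing f with
  | zero =>
    obtain ⟨K, hK⟩ := isCompact_Icc.exists_bound_of_continuousOn (s := Set.Icc (0 : ℝ) 1)
      hf.continuous.continuousOn
    refine ⟨K, fun n _ => ?_⟩
    have hbound : ∀ x ∈ Set.uIoc (0 : ℝ) 1,
        ‖(fourier (-n) (x : AddCircle (1 - 0 : ℝ)) : ℂ) • f x‖ ≤ K := fun x hx => by
      rw [Set.uIoc_of_le zero_le_one] at hx
      rw [norm_smul, fourier_apply, Circle.norm_coe, one_mul]
      exact hK x (Set.Ioc_subset_Icc_self hx)
    rw [fourierCoeffOn_eq_integral]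
    simpa using intervalIntegral.norm_integral_le_of_norm_le_const hbound
  | succ k ih =>
    obtain ⟨hdiff, -, hderiv⟩ := contDiff_succ_iff_deriv.1 (by simpa using hf)
    have hperiodic : Function.Periodic (deriv f) 1 := fun x => by
      rw [← deriv_comp_add_const, funext hper]
    obtain ⟨K, hK⟩ := ih hderiv hperiodic
    refine ⟨K, fun n hn => ?_⟩
    have hf1 : f 1 = f 0 := by simpa using hper 0
    calc ‖fourierCoeffOn zero_lt_one f n‖
        ≤ ‖fourierCoeffOn zero_lt_one (deriv f) n‖ / |(n : ℝ)| :=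
          norm_fourierCoeffOn_le_deriv (fun x => (hdiff x).hasDerivAt) hderiv.continuous hf1 hn
      _ ≤ K / |(n : ℝ)| ^ k / |(n : ℝ)| := by gcongr; exact hK n hn
      _ = K / |(n : ℝ)| ^ (k + 1) := by rw [div_div, pow_succ]

theorem exists_norm_roofCoeff_le_of_contDiff (k : ℕ) {φ : UnitAddCircle → ℝ}
    (hφ : ContDiff ℝ k (fun x : ℝ => φ (x : UnitAddCircle))) :
    ∃ K : ℝ, ∀ m : ℤ, m ≠ 0 → ‖roofCoeff φ m‖ ≤ K / |(m : ℝ)| ^ k := by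
  obtain ⟨K, hK⟩ := norm_fourierCoeffOn_le_of_contDiff k
    (f := fun x => ((φ (x : UnitAddCircle) : ℝ) : ℂ)) (Complex.ofRealCLM.contDiff.comp hφ)
    (fun x => by simp)
  refine ⟨K, fun m hm => ?_⟩
  convert hK m hm using 2
  rw [roofCoeff, fourierCoeff_eq_intervalIntegral _ _ 0, fourierCoeffOn_eq_integral]
  simp

theorem summable_sq_mul_norm_roofCoeff_sq {φ : UnitAddCircle → ℝ}
    (hφ : ContDiff ℝ 3 (fun x : ℝ => φ (x : UnitAddCircle))) :
    Summable fun m : ℤ => ((m : ℝ) ^ 2 * ‖roofCoeff φ m‖) ^ 2 := by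
  obtain ⟨K, hK⟩ := exists_norm_roofCoeff_le_of_contDiff 3 (φ := φ) (by exact_mod_cast hφ)
  refine Summable.of_nonneg_of_le (fun m => by positivity) (fun m => ?_)
    ((Real.summable_one_div_int_pow.2 one_lt_two).mul_left (K ^ 2))
  rcases eq_or_ne m 0 with rfl | hm
  · simp
  calc ((m : ℝ) ^ 2 * ‖roofCoeff φ m‖) ^ 2 ≤ ((m : ℝ) ^ 2 * (K / |(m : ℝ)| ^ 3)) ^ 2 := by
        gcongr; exact hK m hm
    _ = K ^ 2 * (1 / (m : ℝ) ^ 2) := by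
        rw [← sq_abs (m : ℝ)]; field_simp

end FourierDecay

section CircleCharacters

theorem fourier_eq_fourier_one (m : ℤ) (z : UnitAddCircle) : fourier m z = fourier 1 (m • z) := by
  simp [fourier_apply]

theorem fourier_apply_add (m : ℤ) (x y : UnitAddCircle) :
    (fourier m (x + y) : ℂ) = fourier m x * fourier m y := by
  simp [fourier_apply, smul_add, AddCircle.toCircle_add]

theorem norm_fourier_apply (m : ℤ) (x : UnitAddCircle) : ‖(fourier m x : ℂ)‖ = 1 :=
  Circle.norm_coe _

theorem norm_fourier_coe_sub_one (x : ℝ) :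
    ‖fourier 1 (x : UnitAddCircle) - 1‖ = 2 * |Real.sin (Real.pi * x)| := by
  have h := Complex.norm_exp_I_mul_ofReal_sub_one (2 * Real.pi * x)
  rw [show 2 * Real.pi * x / 2 = Real.pi * x by ring, Real.norm_eq_abs, abs_mul, abs_two] at h
  rw [← h, fourier_coe_apply]
  congr 3
  push_cast
  ring

theorem exists_coe_eq_abs_eq_norm (z : UnitAddCircle) :
    ∃ x : ℝ, (x : UnitAddCircle) = z ∧ |x| = ‖z‖ := by
  induction z using QuotientAddGroup.induction_on with
  | H x =>
    refine ⟨x - round x, ?_, (UnitAddCircle.norm_eq (x := x)).symm⟩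
    have hround : ((round x : ℝ) : UnitAddCircle) = 0 :=
      (AddCircle.coe_eq_zero_iff 1).2 ⟨round x, by simp⟩
    rw [AddCircle.coe_sub, hround, sub_zero]

theorem four_mul_norm_le_norm_fourier_sub_one (m : ℤ) (z : UnitAddCircle) :
    4 * ‖m • z‖ ≤ ‖fourier m z - 1‖ := by
  obtain ⟨x, hx, hnorm⟩ := exists_coe_eq_abs_eq_norm (m • z)
  have hhalf : |x| ≤ 1 / 2 := by
    simpa [hnorm] using AddCircle.norm_le_half_period 1 (x := m • z) one_ne_zero
  have habs : |Real.pi * x| = Real.pi * |x| := by rw [abs_mul, abs_of_pos Real.pi_pos]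
  have hjordan := Real.mul_abs_le_abs_sin (x := Real.pi * x) (by
    rw [habs]; nlinarith [Real.pi_pos])
  rw [habs, ← mul_assoc, div_mul_cancel₀ _ Real.pi_ne_zero] at hjordan
  rw [fourier_eq_fourier_one, ← hnorm, ← hx, norm_fourier_coe_sub_one]
  linarith

theorem norm_fourier_sub_one_le (m : ℤ) (z : UnitAddCircle) :
    ‖fourier m z - 1‖ ≤ 2 * Real.pi * ‖m • z‖ := by
  obtain ⟨x, hx, hnorm⟩ := exists_coe_eq_abs_eq_norm (m • z)
  rw [fourier_eq_fourier_one, ← hnorm, ← hx, norm_fourier_coe_sub_one, mul_assoc]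
  have habs : |Real.pi * x| = Real.pi * |x| := by rw [abs_mul, abs_of_pos Real.pi_pos]
  gcongr
  exact Real.abs_sin_le_abs.trans_eq habs

end CircleCharacters

section CoefficientRatios

/-- The ratio `|c_m| / ‖m a‖`, which is comparable to the modulus of the `m`-th Fourier coefficient
of the solution of the cohomological equation over the rotation by `a`. -/
noncomputable def coeffRatio (c : ℤ → ℂ) (a : UnitAddCircle) (m : ℤ) : ℝ := ‖c m‖ / ‖m • a‖

variable {c : ℤ → ℂ} {a : UnitAddCircle} {α : ℝ}

theorem coeffRatio_nonneg (c : ℤ → ℂ) (a : UnitAddCircle) (m : ℤ) : 0 ≤ coeffRatio c a m := by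
  unfold coeffRatio; positivity

theorem coeffRatio_natCast (c : ℤ → ℂ) (a : UnitAddCircle) (m : ℕ) :
    coeffRatio c a m = ‖c m‖ / ‖m • a‖ := by
  rw [coeffRatio, natCast_zsmul]

theorem coeffRatio_neg (hc : ∀ m, c (-m) = starRingEnd ℂ (c m)) (m : ℤ) :
    coeffRatio c a (-m) = coeffRatio c a m := by
  rw [coeffRatio, coeffRatio, hc, RCLike.norm_conj, neg_smul, norm_neg]

/-- The Fourier coefficients `c_m / (e^{2π i m a} - 1)` of the formal solution `W` of
`W (x + a) - W x = ∑ c_m e^{2π i m x}`; the value is `0` if `m a = 0`. -/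
noncomputable def transferCoeff (c : ℤ → ℂ) (a : UnitAddCircle) (m : ℤ) : ℂ :=
  c m / (fourier m a - 1)

theorem norm_transferCoeff_le (c : ℤ → ℂ) (a : UnitAddCircle) (m : ℤ) :
    ‖transferCoeff c a m‖ ≤ coeffRatio c a m := by
  have hlow := four_mul_norm_le_norm_fourier_sub_one m a
  have hup := norm_fourier_sub_one_le m a
  rw [transferCoeff, coeffRatio, norm_div]
  rcases (norm_nonneg (m • a)).eq_or_lt with hzero | hpos
  · rw [← hzero, mul_zero] at hup
    rw [← hzero, hup.antisymm (norm_nonneg _)]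
  · gcongr
    linarith

theorem coeffRatio_le_norm_transferCoeff (c : ℤ → ℂ) (a : UnitAddCircle) (m : ℤ) :
    coeffRatio c a m ≤ 2 * Real.pi * ‖transferCoeff c a m‖ := by
  have hlow := four_mul_norm_le_norm_fourier_sub_one m a
  have hup := norm_fourier_sub_one_le m a
  rw [transferCoeff, coeffRatio, norm_div]
  rcases (norm_nonneg (m • a)).eq_or_lt with hzero | hpos
  · rw [← hzero, div_zero]; positivity
  · rw [← mul_div_assoc, div_le_div_iff₀ hpos (by linarith)]
    nlinarith [norm_nonneg (c m)]

theorem transferCoeff_mul {α : ℝ} (hα : Irrational α) (c : ℤ → ℂ) {m : ℤ} (hm : m ≠ 0) :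
    transferCoeff c α m * (fourier m (α : UnitAddCircle) - 1) = c m := by
  refine div_mul_cancel₀ _ (norm_pos_iff.1 ?_)
  linarith [norm_zsmul_pos hα hm, four_mul_norm_le_norm_fourier_sub_one m (α : UnitAddCircle)]

theorem roofCoeff_neg (φ : UnitAddCircle → ℝ) (m : ℤ) :
    roofCoeff φ (-m) = starRingEnd ℂ (roofCoeff φ m) := by
  rw [roofCoeff, roofCoeff, fourierCoeff, fourierCoeff, ← integral_conj]
  refine integral_congr_ae (ae_of_all _ fun x => ?_)
  simp only [smul_eq_mul, map_mul, Complex.conj_ofReal, ← fourier_neg, neg_neg]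

theorem exists_norm_le_div_sq (hc : Summable fun m : ℤ => ((m : ℝ) ^ 2 * ‖c m‖) ^ 2) :
    ∃ K : ℝ, 0 ≤ K ∧ ∀ m : ℤ, m ≠ 0 → ‖c m‖ ≤ K / (m : ℝ) ^ 2 := by
  refine ⟨√(∑' m : ℤ, ((m : ℝ) ^ 2 * ‖c m‖) ^ 2), Real.sqrt_nonneg _, fun m hm => ?_⟩
  have hm2 : 0 < (m : ℝ) ^ 2 := by positivity
  rw [le_div_iff₀' hm2]
  exact Real.le_sqrt_of_sq_le (hc.le_tsum m fun _ _ => sq_nonneg _)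

theorem summable_norm_of_norm_le_div_sq {K : ℝ}
    (hc : ∀ m : ℤ, m ≠ 0 → ‖c m‖ ≤ K / (m : ℝ) ^ 2) : Summable fun m => ‖c m‖ := by
  have hsq : Summable fun m : ℤ => K * (1 / (m : ℝ) ^ 2) :=
    (Real.summable_one_div_int_pow.2 one_lt_two).mul_left K
  rw [← (Set.finite_singleton (0 : ℤ)).summable_compl_iff] at hsq ⊢
  refine hsq.of_nonneg_of_le (fun _ => norm_nonneg _) fun m => ?_
  exact (hc m m.2).trans_eq (mul_one_div _ _).symm

theorem summable_norm_sq_of_summable_norm (hc : Summable fun m => ‖c m‖) :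
    Summable fun m => ‖c m‖ ^ 2 := by
  refine hc.of_norm_bounded_eventually ?_
  filter_upwards [hc.tendsto_cofinite_zero.eventually_le_const one_pos] with m hm
  rw [norm_pow, norm_norm, sq]
  exact mul_le_of_le_one_left (norm_nonneg _) hm

theorem summable_indicator_coeffRatio_sq_of_le_norm
    (hc : Summable fun m : ℤ => ((m : ℝ) ^ 2 * ‖c m‖) ^ 2) :
    Summable ({m : ℕ | 1 ≤ m ∧ 1 / (2 * (m : ℝ) ^ 2) ≤ ‖m • a‖}.indicator
      fun m : ℕ => coeffRatio c a m ^ 2) := by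
  refine ((hc.comp_injective Nat.cast_injective).mul_left 4).of_nonneg_of_le
    (Set.indicator_nonneg fun _ _ => sq_nonneg _) fun m => ?_
  refine Set.indicator_apply_le' (fun hm => ?_) (fun _ => mul_nonneg zero_le_four (sq_nonneg _))
  have hm0 : (0 : ℝ) < m := by exact_mod_cast hm.1
  rw [coeffRatio_natCast]
  calc (‖c m‖ / ‖m • a‖) ^ 2 ≤ (‖c m‖ / (1 / (2 * (m : ℝ) ^ 2))) ^ 2 := by
        gcongr; exact hm.2
    _ = 4 * (((m : ℤ) : ℝ) ^ 2 * ‖c m‖) ^ 2 := by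
        push_cast; field_simp; ring

theorem summable_norm_multiple_div_sq (hc : Summable fun m => ‖c m‖) (hreg : RegularCoeffs c)
    {b : ℝ} (hb : ∀ m : ℤ, coeffRatio c a m ≤ b) :
    Summable fun z : ℕ × ℕ =>
      (‖c (((z.2 + 2) * (z.1 + 1) : ℕ) : ℤ)‖ / ‖(z.1 + 1) • a‖) ^ 2 := by
  obtain ⟨C, hC, hCle⟩ := hreg
  rw [summable_prod_of_nonneg fun _ => sq_nonneg _]
  constructor
  · intro q
    have hinj : Function.Injective fun l : ℕ => (((l + 2) * (q + 1) : ℕ) : ℤ) := fun l l' h => by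
      have := Nat.eq_of_mul_eq_mul_right q.succ_pos (Int.ofNat.inj h)
      omega
    simp only [div_pow]
    exact ((summable_norm_sq_of_summable_norm hc).comp_injective hinj).div_const _
  · refine (((summable_nat_add_iff 1).2 hC).abs.mul_right (b ^ 2)).of_nonneg_of_le
      (fun q => tsum_nonneg fun l => sq_nonneg _) fun q => ?_
    calc ∑' l : ℕ, (‖c (((l + 2) * (q + 1) : ℕ) : ℤ)‖ / ‖(q + 1) • a‖) ^ 2
        = (∑' l : ℕ, ‖c (((l + 2) * (q + 1) : ℕ) : ℤ)‖ ^ 2) / ‖(q + 1) • a‖ ^ 2 := by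
          simp only [div_pow]; exact tsum_div_const
      _ ≤ C (q + 1) * ‖c ((q + 1 : ℕ) : ℤ)‖ ^ 2 / ‖(q + 1) • a‖ ^ 2 := by
          gcongr; exact hCle (q + 1) q.succ_pos
      _ = C (q + 1) * coeffRatio c a (q + 1 : ℕ) ^ 2 := by
          rw [coeffRatio_natCast, div_pow, mul_div_assoc]
      _ ≤ |C (q + 1)| * b ^ 2 := by
          gcongr
          · exact le_abs_self _
          · exact coeffRatio_nonneg _ _ _
          · exact hb _

theorem exists_eq_multiple_of_lt {m : ℕ} (hm : 1 ≤ m) (hmα : m ∉ goodDenominators α)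
    (h : ‖m • (α : UnitAddCircle)‖ < 1 / (2 * (m : ℝ) ^ 2)) :
    ∃ z : ℕ × ℕ, m = (z.2 + 2) * (z.1 + 1) ∧
      ‖(z.1 + 1) • (α : UnitAddCircle)‖ ≤ ‖m • (α : UnitAddCircle)‖ := by
  obtain ⟨q, hq, l, hl, rfl, hnorm⟩ := exists_goodDenominator_of_lt hm h
  have hl2 : l ≠ 1 := fun hl1 => hmα (by rwa [hl1, one_mul])
  refine ⟨(q - 1, l - 2), ?_, ?_⟩
  · rw [Nat.sub_add_cancel hq.1, Nat.sub_add_cancel (by omega)]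
  · rw [Nat.sub_add_cancel hq.1, hnorm]
    exact le_mul_of_one_le_left (norm_nonneg _) (by exact_mod_cast hl)

theorem summable_indicator_coeffRatio_sq_of_norm_lt (hα : Irrational α)
    (hc : Summable fun m => ‖c m‖) (hreg : RegularCoeffs c) {b : ℝ}
    (hb : ∀ m : ℤ, coeffRatio c α m ≤ b) :
    Summable ({m : ℕ | 1 ≤ m ∧ m ∉ goodDenominators α ∧
        ‖m • (α : UnitAddCircle)‖ < 1 / (2 * (m : ℝ) ^ 2)}.indicator
      fun m : ℕ => coeffRatio c α m ^ 2) := by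
  rw [← summable_subtype_iff_indicator]
  choose i hi hnorm using fun m : {m : ℕ | 1 ≤ m ∧ m ∉ goodDenominators α ∧
    ‖m • (α : UnitAddCircle)‖ < 1 / (2 * (m : ℝ) ^ 2)} =>
      exists_eq_multiple_of_lt m.2.1 m.2.2.1 m.2.2.2
  have hinj : Function.Injective i := fun m m' h => Subtype.ext (by rw [hi, hi, h])
  refine ((summable_norm_multiple_div_sq hc hreg hb).comp_injective hinj).of_nonneg_of_le
    (fun m => sq_nonneg _) fun m => ?_
  simp only [Function.comp_apply]
  rw [coeffRatio_natCast, ← hi m]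
  have hpos : 0 < ‖((i m).1 + 1) • (α : UnitAddCircle)‖ := by
    rw [← natCast_zsmul]
    exact norm_zsmul_pos hα (by positivity)
  gcongr
  exact hnorm m

theorem summable_indicator_compl_coeffRatio_sq (hα : Irrational α)
    (hc : Summable fun m : ℤ => ((m : ℝ) ^ 2 * ‖c m‖) ^ 2) (hreg : RegularCoeffs c) {b : ℝ}
    (hb : ∀ m : ℤ, coeffRatio c α m ≤ b) :
    Summable ((goodDenominators α)ᶜ.indicator fun m : ℕ => coeffRatio c α m ^ 2) := by
  obtain ⟨K, -, hK⟩ := exists_norm_le_div_sq hc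
  have hfar := summable_indicator_coeffRatio_sq_of_le_norm (a := α) hc
  have hnear := summable_indicator_coeffRatio_sq_of_norm_lt hα (summable_norm_of_norm_le_div_sq hK)
    hreg hb
  refine (hfar.add hnear).of_nonneg_of_le (Set.indicator_nonneg fun _ _ => sq_nonneg _) fun m => ?_
  by_cases hm : m ∈ goodDenominators α ∨ m = 0
  · have hzero : (goodDenominators α)ᶜ.indicator (fun m : ℕ => coeffRatio c α m ^ 2) m = 0 := by
      rcases hm with hm | rfl
      · exact Set.indicator_of_notMem (by simpa using hm) _
      · simp [coeffRatio]
    rw [hzero]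
    exact add_nonneg (Set.indicator_nonneg (fun _ _ => sq_nonneg _) _)
      (Set.indicator_nonneg (fun _ _ => sq_nonneg _) _)
  · obtain ⟨hmα, hm0⟩ := not_or.1 hm
    have hm1 : 1 ≤ m := Nat.one_le_iff_ne_zero.2 hm0
    rcases le_or_gt (1 / (2 * (m : ℝ) ^ 2)) ‖m • (α : UnitAddCircle)‖ with h | h
    · rw [Set.indicator_of_mem hmα, Set.indicator_of_mem (Set.mem_ofPred.2 ⟨hm1, h⟩)]
      exact le_add_of_nonneg_right (Set.indicator_nonneg (fun _ _ => sq_nonneg _) _)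
    · rw [Set.indicator_of_mem hmα]
      refine le_add_of_nonneg_of_le (Set.indicator_nonneg (fun _ _ => sq_nonneg _) _) ?_
      rw [Set.indicator_of_mem (Set.mem_ofPred.2 ⟨hm1, hmα, h⟩)]

theorem not_summable_indicator_coeffRatio_sq (hsymm : ∀ m, c (-m) = starRingEnd ℂ (c m))
    {P : Set ℕ} (hcompl : Summable (Pᶜ.indicator fun m : ℕ => coeffRatio c a m ^ 2))
    (hc : ¬ Summable fun m : ℤ => coeffRatio c a m ^ 2) :
    ¬ Summable (P.indicator fun m : ℕ => coeffRatio c a m ^ 2) := by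
  refine fun hP => hc ?_
  have hnat : Summable fun m : ℕ => coeffRatio c a m ^ 2 := by
    have hadd := hP.add hcompl
    rwa [← Pi.add_def, Set.indicator_self_add_compl] at hadd
  exact Summable.of_nat_of_neg hnat (by simpa only [coeffRatio_neg hsymm] using hnat)

theorem summable_indicator_int_coeffRatio_sq (hsymm : ∀ m, c (-m) = starRingEnd ℂ (c m))
    {P : Set ℕ} (hP : Summable (P.indicator fun m : ℕ => coeffRatio c a m ^ 2)) :
    Summable ((Int.natAbs ⁻¹' P).indicator fun m : ℤ => coeffRatio c a m ^ 2) := by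
  refine Summable.of_nat_of_neg (hP.congr fun m => ?_) (hP.congr fun m => ?_)
  · by_cases hm : m ∈ P <;> simp [hm]
  · by_cases hm : m ∈ P <;> simp [hm, coeffRatio_neg hsymm]

end CoefficientRatios

section Cohomology

theorem haarAddCircle_eq_volume :
    (AddCircle.haarAddCircle : Measure UnitAddCircle) = volume := by
  rw [AddCircle.volume_eq_smul_haarAddCircle, ENNReal.ofReal_one, one_smul]

/-- The wave `Re (d e^{2π i q x})` on the circle. -/
noncomputable def wave (d : ℂ) (q : ℕ) (x : UnitAddCircle) : ℝ := (d * fourier (q : ℤ) x).re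

/-- Translation by `a` on `L²` of the circle. -/
noncomputable def translateLp (a : UnitAddCircle) :
    Lp ℂ 2 (AddCircle.haarAddCircle (T := 1)) →L[ℂ] Lp ℂ 2 (AddCircle.haarAddCircle (T := 1)) :=
  (Lp.compMeasurePreservingₗᵢ ℂ (· + a)
    (measurePreserving_add_right AddCircle.haarAddCircle a)).toContinuousLinearMap

theorem coeFn_translateLp (a : UnitAddCircle) (f : Lp ℂ 2 (AddCircle.haarAddCircle (T := 1))) :
    translateLp a f =ᵐ[AddCircle.haarAddCircle] fun x => f (x + a) :=
  Lp.coeFn_compMeasurePreserving f (measurePreserving_add_right _ a)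

theorem translateLp_fourierLp (a : UnitAddCircle) (m : ℤ) :
    translateLp a (fourierLp 2 m) = (fourier m a : ℂ) • fourierLp 2 m := by
  refine Lp.ext ?_
  filter_upwards [coeFn_translateLp a (fourierLp 2 m), Lp.coeFn_smul (fourier m a : ℂ)
    (fourierLp 2 m : Lp ℂ 2 (AddCircle.haarAddCircle (T := 1))), coeFn_fourierLp 2 m,
    (measurePreserving_add_right AddCircle.haarAddCircle a).quasiMeasurePreserving.ae
      (coeFn_fourierLp 2 m)] with x htranslate hsmul hx hxa
  rw [htranslate, hsmul, Pi.smul_apply, hx, hxa, fourier_apply_add, smul_eq_mul, mul_comm]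

theorem ae_eq_tsum_of_hasSum_fourierLp {r : ℤ → ℂ} (hr : Summable fun m => ‖r m‖)
    {g : Lp ℂ 2 (AddCircle.haarAddCircle (T := 1))} (hg : HasSum (fun m => r m • fourierLp 2 m) g) :
    g =ᵐ[AddCircle.haarAddCircle] fun x => ∑' m, r m * fourier m x := by
  have hsum : HasSum (fun m => r m • (fourier m : C(UnitAddCircle, ℂ))) (∑' m, r m • fourier m) :=
    (Summable.of_norm (by simpa only [norm_smul, fourier_norm, mul_one] using hr)).hasSum
  have hLp : ContinuousMap.toLp (E := ℂ) 2 AddCircle.haarAddCircle ℂ (∑' m, r m • fourier m) = g :=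
    (((ContinuousMap.toLp (E := ℂ) 2 AddCircle.haarAddCircle ℂ).hasSum hsum).congr_fun
      fun m => by rw [map_smul]).unique hg
  rw [← hLp]
  filter_upwards [ContinuousMap.coeFn_toLp (p := 2) (𝕜 := ℂ) AddCircle.haarAddCircle
    (∑' m, r m • fourier m : C(UnitAddCircle, ℂ))] with x hx
  rw [hx]
  simpa using ((ContinuousMap.evalCLM ℂ x).hasSum hsum).tsum_eq.symm

theorem exists_coboundary_of_coeffs {a : UnitAddCircle} {r w : ℤ → ℂ}
    (hr : Summable fun m => ‖r m‖) (hw : Summable fun m => ‖w m‖ ^ 2)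
    (hrw : ∀ m, r m = w m * (fourier m a - 1)) :
    ∃ W : UnitAddCircle → ℂ, Measurable W ∧
      ∀ᵐ x : UnitAddCircle, ∑' m, r m * fourier m x = W (x + a) - W x := by
  let W : Lp ℂ 2 (AddCircle.haarAddCircle (T := 1)) :=
    fourierBasis.repr.symm ⟨w, memℓp_gen (by simpa using hw)⟩
  have hW : HasSum (fun m => w m • fourierLp 2 m) W := by
    simpa [W, coe_fourierBasis] using (fourierBasis (T := 1)).hasSum_repr W
  have hsub : HasSum (fun m => r m • fourierLp 2 m) (translateLp a W - W) := by
    refine (((translateLp a).hasSum hW).sub hW).congr_fun fun m => ?_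
    rw [map_smul, translateLp_fourierLp, hrw, smul_smul, ← sub_smul, mul_sub, mul_one]
  refine ⟨W, (Lp.stronglyMeasurable W).measurable, ?_⟩
  rw [← haarAddCircle_eq_volume]
  filter_upwards [ae_eq_tsum_of_hasSum_fourierLp hr hsub, Lp.coeFn_sub (translateLp a W) W,
    coeFn_translateLp a W] with x hx hsub hshift
  rw [← hx, hsub, Pi.sub_apply, hshift]

theorem tsum_fourier_eq_tsum_wave {c : ℤ → ℂ} (hc : Summable fun m => ‖c m‖) (hc0 : c 0 = 0)
    (hsymm : ∀ m, c (-m) = starRingEnd ℂ (c m)) (x : UnitAddCircle) :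
    ∑' m, c m * fourier m x = ((∑' m : ℕ, wave (2 * c m) m x : ℝ) : ℂ) := by
  have hsum : Summable fun m => c m * fourier m x :=
    Summable.of_norm (by simpa only [norm_mul, norm_fourier_apply, mul_one] using hc)
  have hnat := hsum.hasSum.nat_add_neg
  rw [hc0, zero_mul, add_zero] at hnat
  rw [← hnat.tsum_eq, Complex.ofReal_tsum]
  refine tsum_congr fun m => ?_
  rw [hsymm, fourier_neg, ← map_mul, Complex.add_conj, wave, mul_assoc]
  simp

theorem exists_coboundary_of_summable_coeffRatio_sq {α : ℝ} (hα : Irrational α) {r : ℤ → ℂ}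
    (hr : Summable fun m => ‖r m‖) (hratio : Summable fun m => coeffRatio r α m ^ 2) :
    ∃ W : UnitAddCircle → ℂ, Measurable W ∧
      ∀ᵐ x, ∑' m, r m * fourier m x = r 0 + (W (x + (α : UnitAddCircle)) - W x) := by
  let r₀ : ℤ → ℂ := fun m => if m = 0 then 0 else r m
  have hr₀ : Summable fun m => ‖r₀ m‖ := hr.of_nonneg_of_le (fun _ => norm_nonneg _) fun m => by
    by_cases hm : m = 0 <;> simp [r₀, hm]
  obtain ⟨W, hWm, hW⟩ := exists_coboundary_of_coeffs (a := α) (w := transferCoeff r₀ α) hr₀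
    (hratio.of_nonneg_of_le (fun _ => sq_nonneg _) fun m => by
      refine pow_le_pow_left₀ (norm_nonneg _) ((norm_transferCoeff_le r₀ α m).trans ?_) 2
      by_cases hm : m = 0 <;> simp [r₀, hm, coeffRatio])
    fun m => by
      rcases eq_or_ne m 0 with rfl | hm
      · simp [r₀]
      · exact (transferCoeff_mul hα r₀ hm).symm
  refine ⟨W, hWm, ?_⟩
  filter_upwards [hW] with x hx
  have hsum : Summable fun m => r m * fourier m x :=
    Summable.of_norm (by simpa only [norm_mul, norm_fourier_apply, mul_one] using hr)
  rw [hsum.tsum_eq_add_tsum_ite 0, ← hx]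
  simp [r₀, ite_mul]

theorem exists_cohomologous_lacunary {α : ℝ} (hα : Irrational α) {φ : UnitAddCircle → ℝ}
    (hφ : Continuous φ) (hc : Summable fun m => ‖roofCoeff φ m‖) {P : Set ℕ} (hP : 0 ∉ P)
    (hratio : Summable
      ((Int.natAbs ⁻¹' Pᶜ).indicator fun m => coeffRatio (roofCoeff φ) α m ^ 2)) :
    ∃ W : UnitAddCircle → ℝ, Measurable W ∧ ∀ᵐ x, φ x = (roofCoeff φ 0).re +
      ∑' m : ℕ, P.indicator (fun m => wave (2 * roofCoeff φ m) m x) m +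
      (W (x + (α : UnitAddCircle)) - W x) := by
  classical
  let s : ℤ → ℂ := (Int.natAbs ⁻¹' P).indicator (roofCoeff φ)
  let r : ℤ → ℂ := (Int.natAbs ⁻¹' P)ᶜ.indicator (roofCoeff φ)
  have hs : Summable fun m => ‖s m‖ :=
    hc.of_nonneg_of_le (fun _ => norm_nonneg _) fun m => norm_indicator_le_norm_self _ _
  have hr : Summable fun m => ‖r m‖ :=
    hc.of_nonneg_of_le (fun _ => norm_nonneg _) fun m => norm_indicator_le_norm_self _ _
  have hsymm : ∀ m, s (-m) = starRingEnd ℂ (s m) := fun m => by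
    by_cases hm : m.natAbs ∈ P <;> simp [s, hm, roofCoeff_neg]
  have hr0 : r 0 = roofCoeff φ 0 := by simp [r, hP]
  obtain ⟨W, hWm, hW⟩ := exists_coboundary_of_summable_coeffRatio_sq hα hr (hratio.congr fun m => by
    by_cases hm : m.natAbs ∈ P <;> simp [r, coeffRatio, hm])
  refine ⟨fun x => (W x).re, Complex.measurable_re.comp hWm, ?_⟩
  filter_upwards [hW] with x hx
  have hsum : ∀ {d : ℤ → ℂ}, (Summable fun m => ‖d m‖) → Summable fun m => d m * fourier m x :=
    fun hd => Summable.of_norm (by simpa only [norm_mul, norm_fourier_apply, mul_one] using hd)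
  have hφx : (φ x : ℂ) = ∑' m, s m * fourier m x + ∑' m, r m * fourier m x :=
    calc (φ x : ℂ) = ∑' m, roofCoeff φ m * fourier m x :=
          (has_pointwise_sum_fourier_series_of_summable
            (f := ⟨fun x => (φ x : ℂ), by fun_prop⟩) hc.of_norm x).tsum_eq.symm
      _ = ∑' m, (s m * fourier m x + r m * fourier m x) := by
          refine tsum_congr fun m => ?_
          rw [← add_mul, Set.indicator_self_add_compl_apply]
      _ = _ := (hsum hs).tsum_add (hsum hr)
  have hwave : ∀ m : ℕ, wave (2 * s m) m x =
      P.indicator (fun m => wave (2 * roofCoeff φ m) m x) m := fun m => by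
    by_cases hm : m ∈ P <;> simp [s, wave, hm]
  rw [tsum_fourier_eq_tsum_wave hs (by simp [s, hP]) hsymm, hx, hr0] at hφx
  have hre := congrArg Complex.re hφx
  simp only [Complex.add_re, Complex.sub_re, Complex.ofReal_re, hwave] at hre
  rw [hre]
  ring

end Cohomology

section OscillatoryIntegrals

instance isProbabilityMeasure_volume_unitAddCircle :
    IsProbabilityMeasure (volume : Measure UnitAddCircle) :=
  ⟨UnitAddCircle.measure_univ⟩

theorem integrable_of_continuous {E : Type*} [NormedAddCommGroup E] {f : UnitAddCircle → E}
    (hf : Continuous f) : Integrable f :=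
  hf.integrable_of_hasCompactSupport (HasCompactSupport.of_compactSpace _)

theorem norm_coe_unitAddCircle_le_abs (x : ℝ) : ‖(x : UnitAddCircle)‖ ≤ |x| := by
  simpa [UnitAddCircle.norm_eq] using round_le x 0

theorem exists_norm_sub_zsmul_inv_le {q : ℕ} (hq : 1 ≤ q) (u : UnitAddCircle) :
    ∃ j : ℤ, ‖u - j • (((q : ℝ)⁻¹ : ℝ) : UnitAddCircle)‖ ≤ (q : ℝ)⁻¹ := by
  have hq0 : (0 : ℝ) < q := by exact_mod_cast hq
  obtain ⟨y, rfl, -⟩ := exists_coe_eq_abs_eq_norm u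
  refine ⟨⌊y * q⌋, ?_⟩
  rw [zsmul_coe_unitAddCircle, ← AddCircle.coe_sub]
  refine (norm_coe_unitAddCircle_le_abs _).trans ?_
  rw [show y - (⌊y * q⌋ : ℝ) * (q : ℝ)⁻¹ = Int.fract (y * q) * (q : ℝ)⁻¹ by
    rw [Int.fract, sub_mul, mul_inv_cancel_right₀ hq0.ne'],
    abs_mul, abs_of_nonneg (Int.fract_nonneg _), abs_of_pos (inv_pos.2 hq0)]
  exact mul_le_of_le_one_left (by positivity) (Int.fract_lt_one _).le

variable {A B : UnitAddCircle → ℂ} {L : ℝ} {q : ℕ}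

theorem norm_integral_mul_sub_integral_shift_mul_le (hA : Continuous A) (hB : Continuous B)
    (hL : 0 ≤ L) (hLip : ∀ x y, ‖A x - A y‖ ≤ L * ‖x - y‖) (hB1 : ∀ x, ‖B x‖ ≤ 1) (hq : 1 ≤ q)
    (hper : Function.Periodic B (((q : ℝ)⁻¹ : ℝ) : UnitAddCircle)) (u : UnitAddCircle) :
    ‖(∫ x, A x * B x) - ∫ x, A (x + u) * B x‖ ≤ L / q := by
  obtain ⟨j, hj⟩ := exists_norm_sub_zsmul_inv_le hq u
  set v := u - j • (((q : ℝ)⁻¹ : ℝ) : UnitAddCircle) with hv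
  have hshift : ∫ x, A (x + u) * B x = ∫ x, A (x + v) * B x := by
    rw [← integral_add_right_eq_self (fun x => A (x + v) * B x)
      (j • (((q : ℝ)⁻¹ : ℝ) : UnitAddCircle))]
    refine integral_congr_ae (ae_of_all _ fun x => ?_)
    simp only [hper.zsmul j x, hv]
    congr 2
    abel
  have hpoint : ∀ x, ‖A x * B x - A (x + v) * B x‖ ≤ L / q := fun x =>
    calc ‖A x * B x - A (x + v) * B x‖ = ‖A x - A (x + v)‖ * ‖B x‖ := by rw [← sub_mul, norm_mul]
      _ ≤ L * ‖x - (x + v)‖ * 1 := by gcongr; exacts [hLip _ _, hB1 x]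
      _ = L * ‖v‖ := by rw [sub_add_cancel_left, norm_neg, mul_one]
      _ ≤ L / q := by rw [div_eq_mul_inv]; gcongr
  rw [hshift, ← integral_sub (integrable_of_continuous (by fun_prop))
    (integrable_of_continuous (by fun_prop))]
  simpa using norm_integral_le_of_norm_le_const (μ := volume) (ae_of_all _ hpoint)

theorem integral_integral_shift_mul (hA : Continuous A) (hB : Continuous B) :
    ∫ u, ∫ x, A (x + u) * B x = (∫ x, A x) * ∫ x, B x := by
  rw [integral_integral_swap]
  · simp_rw [integral_mul_const, integral_add_left_eq_self A]
    rw [integral_const_mul]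
  · exact Continuous.integrable_of_hasCompactSupport (by fun_prop)
      (HasCompactSupport.of_compactSpace _)

theorem norm_integral_mul_sub_le (hA : Continuous A) (hB : Continuous B) (hL : 0 ≤ L)
    (hLip : ∀ x y, ‖A x - A y‖ ≤ L * ‖x - y‖) (hB1 : ∀ x, ‖B x‖ ≤ 1) (hq : 1 ≤ q)
    (hper : Function.Periodic B (((q : ℝ)⁻¹ : ℝ) : UnitAddCircle)) :
    ‖(∫ x, A x * B x) - (∫ x, A x) * ∫ x, B x‖ ≤ L / q := by
  have hcont : Continuous fun u => ∫ x, A (x + u) * B x := by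
    simpa using continuous_parametric_integral_of_continuous (μ := volume)
      (f := fun u x => A (x + u) * B x) (by fun_prop) isCompact_univ
  have haverage : (∫ x, A x * B x) - (∫ x, A x) * ∫ x, B x =
      ∫ u, ((∫ x, A x * B x) - ∫ x, A (x + u) * B x) := by
    rw [integral_sub (integrable_const _) (integrable_of_continuous hcont), integral_const,
      integral_integral_shift_mul hA hB, probReal_univ, one_smul]
  rw [haverage]
  simpa using norm_integral_le_of_norm_le_const (μ := volume) (ae_of_all _
    (norm_integral_mul_sub_integral_shift_mul_le hA hB hL hLip hB1 hq hper))

theorem integral_fourier_eq_zero {m : ℤ} (hm : m ≠ 0) :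
    ∫ x : UnitAddCircle, (fourier m x : ℂ) = 0 := by
  have hcoeff := congrFun (fourierCoeff_fourier (T := 1) m) 0
  rw [fourierCoeff, haarAddCircle_eq_volume, Pi.single_eq_of_ne hm.symm] at hcoeff
  simpa using hcoeff

@[fun_prop]
theorem continuous_wave (d : ℂ) (q : ℕ) : Continuous (wave d q) := by
  unfold wave
  fun_prop

theorem abs_wave_le (d : ℂ) (q : ℕ) (x : UnitAddCircle) : |wave d q x| ≤ ‖d‖ := by
  refine (Complex.abs_re_le_norm _).trans_eq ?_
  rw [norm_mul, norm_fourier_apply, mul_one]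

theorem wave_apply_add (d : ℂ) (q : ℕ) (x a : UnitAddCircle) :
    wave d q (x + a) = wave (d * fourier (q : ℤ) a) q x := by
  rw [wave, wave, fourier_apply_add, mul_comm (fourier (q : ℤ) x), mul_assoc]

theorem wave_sub_left (d d' : ℂ) (q : ℕ) (x : UnitAddCircle) :
    wave (d - d') q x = wave d q x - wave d' q x := by
  rw [wave, wave, wave, sub_mul, Complex.sub_re]

theorem abs_wave_sub_le (d : ℂ) (q : ℕ) (x y : UnitAddCircle) :
    |wave d q x - wave d q y| ≤ ‖d‖ * (2 * Real.pi * q) * ‖x - y‖ := by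
  have hxy : wave d q x - wave d q y = wave (d * (fourier (q : ℤ) (x - y) - 1)) q y := by
    rw [mul_sub, mul_one, wave_sub_left, ← wave_apply_add, add_sub_cancel]
  rw [hxy]
  calc |wave (d * (fourier (q : ℤ) (x - y) - 1)) q y|
      ≤ ‖d‖ * ‖(fourier (q : ℤ) (x - y) : ℂ) - 1‖ := (abs_wave_le _ _ _).trans_eq (norm_mul _ _)
    _ ≤ ‖d‖ * (2 * Real.pi * (q * ‖x - y‖)) := by
        gcongr
        refine (norm_fourier_sub_one_le _ _).trans ?_
        rw [natCast_zsmul]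
        gcongr
        exact norm_nsmul_le
    _ = ‖d‖ * (2 * Real.pi * q) * ‖x - y‖ := by ring

theorem periodic_wave (d : ℂ) (hq : 1 ≤ q) :
    Function.Periodic (wave d q) (((q : ℝ)⁻¹ : ℝ) : UnitAddCircle) := fun x => by
  have hq0 : (q : ℝ) ≠ 0 := by positivity
  have hone : fourier (q : ℤ) (((q : ℝ)⁻¹ : ℝ) : UnitAddCircle) = 1 := by
    rw [fourier_eq_fourier_one, zsmul_coe_unitAddCircle, Int.cast_natCast, mul_inv_cancel₀ hq0,
      AddCircle.coe_period, fourier_eval_zero]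
  rw [wave_apply_add, hone, mul_one]

theorem integral_wave (d : ℂ) (hq : 1 ≤ q) : ∫ x, wave d q x = 0 := by
  have hre := integral_re (integrable_of_continuous
    (f := fun x => d * (fourier (q : ℤ) x : ℂ)) (by fun_prop))
  rw [integral_const_mul, integral_fourier_eq_zero (by omega), mul_zero] at hre
  simpa [wave] using hre

theorem wave_sq (d : ℂ) (q : ℕ) (x : UnitAddCircle) :
    wave d q x ^ 2 = ‖d‖ ^ 2 / 2 + wave (d ^ 2 / 2) (2 * q) x := by
  set z := d * (fourier (q : ℤ) x : ℂ) with hz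
  have hdouble : d ^ 2 / 2 * (fourier ((2 * q : ℕ) : ℤ) x : ℂ) = z * z / 2 := by
    rw [hz, Nat.cast_mul, Nat.cast_two, two_mul, fourier_add]
    ring
  have hnorm : ‖d‖ ^ 2 = z.re ^ 2 + z.im ^ 2 := by
    have hzd : ‖z‖ = ‖d‖ := by rw [hz, norm_mul, norm_fourier_apply, mul_one]
    rw [← hzd, Complex.sq_norm, Complex.normSq_apply, sq, sq]
  rw [wave, wave, hdouble, Complex.div_ofNat_re, Complex.mul_re z z, ← hz, hnorm]
  ring

theorem integral_wave_sq (d : ℂ) (hq : 1 ≤ q) : ∫ x, wave d q x ^ 2 = ‖d‖ ^ 2 / 2 := by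
  simp_rw [wave_sq]
  rw [integral_add (integrable_const _) (integrable_of_continuous (by fun_prop)),
    integral_wave _ (by omega)]
  simp

theorem norm_cexp_mul_I_sub_le {u : ℝ} (hu : |u| ≤ 1) :
    ‖Complex.exp (u * Complex.I) - (1 + u * Complex.I - (u : ℂ) ^ 2 / 2)‖ ≤ u ^ 2 * (2 / 9) := by
  have hnorm : ‖(u * Complex.I : ℂ)‖ = |u| := by simp
  have htaylor : ∑ m ∈ Finset.range 3, (u * Complex.I : ℂ) ^ m / (m.factorial : ℂ) =
      1 + u * Complex.I - (u : ℂ) ^ 2 / 2 := by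
    simp [Finset.sum_range_succ, Nat.factorial, mul_pow]
    ring
  have hcube : |u| ^ 3 ≤ u ^ 2 := by
    rw [← sq_abs u]
    exact pow_le_pow_of_le_one (abs_nonneg u) hu (by norm_num)
  have hbound := Complex.exp_bound (hnorm.trans_le hu) (n := 3) (by norm_num)
  rw [hnorm, htaylor] at hbound
  refine hbound.trans ?_
  norm_num [Nat.factorial]
  linarith

theorem integral_taylor_wave (d : ℂ) (hq : 1 ≤ q) :
    ∫ x, (1 + wave d q x * Complex.I - (wave d q x : ℂ) ^ 2 / 2) =
      ((1 - ‖d‖ ^ 2 / 4 : ℝ) : ℂ) := by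
  have hlinear : ∫ x, (wave d q x : ℂ) = 0 := by
    rw [integral_complex_ofReal, integral_wave d hq, Complex.ofReal_zero]
  have hquadratic : ∫ x, (wave d q x : ℂ) ^ 2 = ((‖d‖ ^ 2 / 2 : ℝ) : ℂ) := by
    rw [← integral_wave_sq d hq, ← integral_complex_ofReal]
    push_cast
    rfl
  rw [integral_sub (integrable_of_continuous (by fun_prop))
      (integrable_of_continuous (by fun_prop)),
    integral_add (integrable_const _) (integrable_of_continuous (by fun_prop)),
    integral_mul_const, hlinear, integral_div, hquadratic, integral_const, probReal_univ, one_smul]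
  push_cast
  ring

theorem norm_integral_cexp_wave_le (d : ℂ) (hq : 1 ≤ q) (hd : ‖d‖ ≤ 1) :
    ‖∫ x, Complex.exp (wave d q x * Complex.I)‖ ≤ Real.exp (-(‖d‖ ^ 2 / 8)) := by
  have hdiff : ‖(∫ x, Complex.exp (wave d q x * Complex.I)) - ((1 - ‖d‖ ^ 2 / 4 : ℝ) : ℂ)‖ ≤
      ‖d‖ ^ 2 / 2 * (2 / 9) := by
    rw [← integral_taylor_wave d hq, ← integral_sub (integrable_of_continuous (by fun_prop))
      (integrable_of_continuous (by fun_prop)), ← integral_wave_sq d hq, ← integral_mul_const]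
    exact norm_integral_le_of_norm_le (integrable_of_continuous (by fun_prop))
      (ae_of_all _ fun x => norm_cexp_mul_I_sub_le ((abs_wave_le d q x).trans hd))
  have hmain : ‖((1 - ‖d‖ ^ 2 / 4 : ℝ) : ℂ)‖ = 1 - ‖d‖ ^ 2 / 4 := by
    rw [Complex.norm_real, Real.norm_of_nonneg]
    nlinarith [norm_nonneg d]
  calc ‖∫ x, Complex.exp (wave d q x * Complex.I)‖
      ≤ 1 - ‖d‖ ^ 2 / 4 + ‖d‖ ^ 2 / 2 * (2 / 9) :=
        (norm_le_norm_add_norm_sub' _ _).trans (by rw [hmain]; gcongr)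
    _ ≤ -(‖d‖ ^ 2 / 8) + 1 := by nlinarith [sq_nonneg ‖d‖]
    _ ≤ Real.exp (-(‖d‖ ^ 2 / 8)) := Real.add_one_le_exp _

end OscillatoryIntegrals

section SuperLacunarySequences

theorem norm_cexp_sub_cexp_le (x y : ℝ) :
    ‖Complex.exp (x * Complex.I) - Complex.exp (y * Complex.I)‖ ≤ |x - y| := by
  have hfactor : Complex.exp (x * Complex.I) - Complex.exp (y * Complex.I) =
      Complex.exp (y * Complex.I) * (Complex.exp (Complex.I * (x - y : ℝ)) - 1) := by
    rw [mul_sub, ← Complex.exp_add, mul_one]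
    congr 2
    push_cast
    ring
  rw [hfactor, norm_mul, Complex.norm_exp_ofReal_mul_I, one_mul]
  exact Real.norm_exp_I_mul_ofReal_sub_one_le

theorem abs_sum_wave_sub_le {d : ℕ → ℂ} (q : ℕ → ℕ) {s : Finset ℕ} (hd : ∀ n ∈ s, ‖d n‖ ≤ 1)
    (x y : UnitAddCircle) :
    |∑ n ∈ s, wave (d n) (q n) x - ∑ n ∈ s, wave (d n) (q n) y| ≤
      2 * Real.pi * (∑ n ∈ s, (q n : ℝ)) * ‖x - y‖ := by
  rw [← Finset.sum_sub_distrib, Finset.mul_sum, Finset.sum_mul]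
  refine (Finset.abs_sum_le_sum_abs _ _).trans (Finset.sum_le_sum fun n hn => ?_)
  refine (abs_wave_sub_le _ _ _ _).trans ?_
  exact mul_le_mul_of_nonneg_right
    (mul_le_of_le_one_left (by positivity) (hd n hn)) (norm_nonneg _)

theorem exists_nsmul_near_half_period {a : UnitAddCircle} {q q' : ℕ} (hq : 1 ≤ q)
    (hlt : ‖q • a‖ < 1 / (2 * (q : ℝ) ^ 2)) (hge : 1 / 2 ≤ q' * ‖q • a‖) :
    ∃ s ≤ q', ‖s • a‖ ≤ 1 / (2 * q) ∧ 1 / 2 - 1 / (2 * q) ≤ ‖q • s • a‖ := by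
  obtain ⟨y, hy, hynorm⟩ := exists_coe_eq_abs_eq_norm (q • a)
  rw [← hynorm] at hlt hge
  have hq0 : (0 : ℝ) < q := by exact_mod_cast hq
  have hy0 : 0 < |y| := pos_of_mul_pos_right (one_half_pos.trans_le hge) q'.cast_nonneg
  set r := ⌊1 / (2 * (q : ℝ) * |y|)⌋₊
  have hr : (r : ℝ) * (2 * q * |y|) ≤ 1 :=
    (le_div_iff₀ (by positivity)).1 (Nat.floor_le (by positivity))
  have hr' : 1 < (r + 1 : ℝ) * (2 * q * |y|) :=
    (div_lt_iff₀ (by positivity)).1 (Nat.lt_floor_add_one _)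
  have hqy : (q : ℝ) * |y| ≤ 1 / (2 * q) := by
    rw [lt_div_iff₀ (by positivity)] at hlt
    rw [le_div_iff₀ (by positivity)]
    linarith
  have hsmul : (r * q) • a = ((r * y : ℝ) : UnitAddCircle) := by
    rw [mul_smul, ← hy, nsmul_coe_unitAddCircle]
  refine ⟨r * q, ?_, ?_, ?_⟩
  · have hle : (r * q : ℝ) * |y| ≤ q' * |y| := by linarith
    exact_mod_cast le_of_mul_le_mul_right hle hy0
  · rw [hsmul, le_div_iff₀ (by positivity)]
    calc ‖((r * y : ℝ) : UnitAddCircle)‖ * (2 * q) ≤ |r * y| * (2 * q) := by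
          gcongr
          exact norm_coe_unitAddCircle_le_abs _
      _ = r * (2 * q * |y|) := by rw [abs_mul, Nat.abs_cast]; ring
      _ ≤ 1 := hr
  · have habs : |(q : ℝ) * (r * y)| = q * r * |y| := by
      rw [abs_mul, abs_mul, Nat.abs_cast, Nat.abs_cast, mul_assoc]
    have hnorm : ‖((q * (r * y) : ℝ) : UnitAddCircle)‖ = |(q : ℝ) * (r * y)| :=
      (AddCircle.norm_coe_eq_abs_iff 1 one_ne_zero).2 (by rw [habs, abs_one]; linarith)
    rw [hsmul, nsmul_coe_unitAddCircle, hnorm, habs]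
    linarith

/-- A sequence of denominators of very good approximations of the rotation by `a`: each `q n • a` is
much closer to `0` than `1 / q n`, but not closer than `1 / (2 q (n + 1))`. -/
structure SuperLacunary (a : UnitAddCircle) (q : ℕ → ℕ) : Prop where
  one_le : ∀ n, 1 ≤ q n
  lt_succ : ∀ n, q n < q (n + 1)
  sq_le : ∀ n, q n ^ 2 ≤ q (n + 1)
  norm_lt : ∀ n, ‖q n • a‖ < 1 / (2 * (q n : ℝ) ^ 2)
  half_le : ∀ n, 1 / 2 ≤ q (n + 1) * ‖q n • a‖

namespace SuperLacunary

variable {a : UnitAddCircle} {q : ℕ → ℕ}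

theorem cast_pos (h : SuperLacunary a q) (n : ℕ) : (0 : ℝ) < q n := by
  exact_mod_cast h.one_le n

theorem two_mul_le (h : SuperLacunary a q) (n : ℕ) : 2 * q n ≤ q (n + 1) := by
  have hlt := h.lt_succ n
  have hsq := h.sq_le n
  rcases Nat.lt_or_ge (q n) 2 with hsmall | hlarge
  · have := h.one_le n
    omega
  · exact (Nat.mul_le_mul_right _ hlarge).trans (by rwa [← sq])

theorem two_pow_le (h : SuperLacunary a q) (n : ℕ) : 2 ^ n ≤ q n := by
  induction n with
  | zero => simpa using h.one_le 0
  | succ n ih =>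
    have := h.two_mul_le n
    rw [pow_succ]
    omega

theorem two_pow_mul_le (h : SuperLacunary a q) (n : ℕ) : 2 ^ n * q n ≤ q (n + 1) :=
  (Nat.mul_le_mul_right _ (h.two_pow_le n)).trans ((sq (q n)).symm.le.trans (h.sq_le n))

theorem inv_le (h : SuperLacunary a q) (n : ℕ) : 1 / (q n : ℝ) ≤ (1 / 2) ^ n := by
  rw [one_div_pow]
  exact one_div_le_one_div_of_le (by positivity) (by exact_mod_cast h.two_pow_le n)

theorem div_succ_le (h : SuperLacunary a q) (n : ℕ) : (q n : ℝ) / q (n + 1) ≤ (1 / 2) ^ n := by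
  rw [one_div_pow, div_le_div_iff₀ (h.cast_pos _) (by positivity), one_mul, mul_comm]
  exact_mod_cast h.two_pow_mul_le n

theorem monotone (h : SuperLacunary a q) : Monotone q :=
  monotone_nat_of_le_succ fun n => (h.lt_succ n).le

theorem sum_range_le (h : SuperLacunary a q) (n : ℕ) : ∑ i ∈ Finset.range n, q i ≤ q n := by
  induction n with
  | zero => simp
  | succ n ih =>
    have := h.two_mul_le n
    rw [Finset.sum_range_succ]
    omega

theorem sum_range_div_le (h : SuperLacunary a q) (n : ℕ) :
    (∑ i ∈ Finset.range n, (q i : ℝ)) / q n ≤ 4 * (1 / 2) ^ n := by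
  rcases n with _ | n
  · simp
  · have hsum : (∑ i ∈ Finset.range n, (q i : ℝ)) ≤ q n := by exact_mod_cast h.sum_range_le n
    calc (∑ i ∈ Finset.range (n + 1), (q i : ℝ)) / q (n + 1) ≤ 2 * q n / q (n + 1) := by
          rw [Finset.sum_range_succ]
          gcongr
          linarith
      _ = 2 * (q n / q (n + 1)) := mul_div_assoc _ _ _
      _ ≤ 2 * (1 / 2) ^ n := by gcongr; exact h.div_succ_le n
      _ = 4 * (1 / 2) ^ (n + 1) := by ring

theorem sum_Ico_inv_le (h : SuperLacunary a q) {N M : ℕ} (hNM : N ≤ M) :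
    ∑ j ∈ Finset.Ico N M, 1 / (q j : ℝ) ≤ 2 / q N := by
  have htelescope : ∑ j ∈ Finset.Ico N M, 1 / (q j : ℝ) + 2 / q M ≤ 2 / q N := by
    induction M, hNM using Nat.le_induction with
    | base => simp
    | succ M hM ih =>
      have hstep : 2 / (q (M + 1) : ℝ) ≤ 1 / q M := by
        rw [div_le_div_iff₀ (h.cast_pos _) (h.cast_pos _), one_mul]
        exact_mod_cast h.two_mul_le M
      rw [Finset.sum_Ico_succ_top hM]
      linarith [add_div 1 1 (q M : ℝ), one_add_one_eq_two (R := ℝ)]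
  exact (le_add_of_nonneg_right (by positivity)).trans htelescope

section AlmostIndependence

variable {d : ℕ → ℂ} {N M : ℕ}

theorem norm_integral_cexp_sum_wave_succ_sub_le (h : SuperLacunary a q)
    (hd : ∀ n ∈ Finset.Ico N M, ‖d n‖ ≤ 1) (hNM : N ≤ M) :
    ‖(∫ x, Complex.exp ((∑ n ∈ Finset.Ico N (M + 1), wave (d n) (q n) x : ℝ) * Complex.I)) -
      (∫ x, Complex.exp ((∑ n ∈ Finset.Ico N M, wave (d n) (q n) x : ℝ) * Complex.I)) *
        ∫ x, Complex.exp (wave (d M) (q M) x * Complex.I)‖ ≤ 8 * Real.pi * (1 / 2) ^ M := by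
  have hlip : 2 * Real.pi * (∑ n ∈ Finset.Ico N M, (q n : ℝ)) / q M ≤
      8 * Real.pi * (1 / 2) ^ M :=
    calc 2 * Real.pi * (∑ n ∈ Finset.Ico N M, (q n : ℝ)) / q M
        ≤ 2 * Real.pi * ((∑ n ∈ Finset.range M, (q n : ℝ)) / q M) := by
          rw [mul_div_assoc]
          gcongr
          exact fun n hn => Finset.mem_range.2 (Finset.mem_Ico.1 hn).2
      _ ≤ 2 * Real.pi * (4 * (1 / 2) ^ M) := by gcongr; exact h.sum_range_div_le M
      _ = 8 * Real.pi * (1 / 2) ^ M := by ring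
  simp_rw [Finset.sum_Ico_succ_top hNM, Complex.ofReal_add, add_mul, Complex.exp_add]
  refine le_trans (norm_integral_mul_sub_le (by fun_prop) (by fun_prop) (by positivity)
    (fun x y => (norm_cexp_sub_cexp_le _ _).trans (abs_sum_wave_sub_le q hd x y))
    (fun x => (Complex.norm_exp_ofReal_mul_I _).le) (h.one_le M) fun x => ?_) hlip
  rw [periodic_wave _ (h.one_le M)]

theorem norm_integral_cexp_sum_wave_le (h : SuperLacunary a q) (hd : ∀ n, N ≤ n → ‖d n‖ ≤ 1)
    (hNM : N ≤ M) :
    ‖∫ x, Complex.exp ((∑ n ∈ Finset.Ico N M, wave (d n) (q n) x : ℝ) * Complex.I)‖ ≤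
      Real.exp (-(∑ n ∈ Finset.Ico N M, ‖d n‖ ^ 2 / 8)) +
        8 * Real.pi * ∑ n ∈ Finset.Ico N M, (1 / 2) ^ n := by
  induction M, hNM using Nat.le_induction with
  | base => simp
  | succ M hM ih =>
    have hdecorrelate := h.norm_integral_cexp_sum_wave_succ_sub_le
      (fun n hn => hd n (Finset.mem_Ico.1 hn).1) hM
    have hwave := norm_integral_cexp_wave_le (d M) (h.one_le M) (hd M hM)
    rw [Finset.sum_Ico_succ_top hM, Finset.sum_Ico_succ_top hM, neg_add, Real.exp_add]
    set I := ∫ x, Complex.exp ((∑ n ∈ Finset.Ico N M, wave (d n) (q n) x : ℝ) * Complex.I)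
    set J := ∫ x, Complex.exp (wave (d M) (q M) x * Complex.I)
    set E := Real.exp (-∑ n ∈ Finset.Ico N M, ‖d n‖ ^ 2 / 8)
    set F := Real.exp (-(‖d M‖ ^ 2 / 8))
    set S := ∑ n ∈ Finset.Ico N M, (1 / 2 : ℝ) ^ n
    have hF : F ≤ 1 := Real.exp_le_one_iff.2 (neg_nonpos.2 (by positivity))
    have hproduct : ‖I * J‖ ≤ E * F + 8 * Real.pi * S :=
      calc ‖I * J‖ ≤ (E + 8 * Real.pi * S) * F := by rw [norm_mul]; gcongr
        _ ≤ E * F + 8 * Real.pi * S := by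
          rw [add_mul]
          exact add_le_add_right (mul_le_of_le_one_right (by positivity) hF) _
    refine (norm_le_norm_add_norm_sub' _ (I * J)).trans ?_
    linarith

end AlmostIndependence

section ReturnTimes

variable {s : ℕ → ℕ} {N M : ℕ}

theorem sum_Ico_le (h : SuperLacunary a q) (hs : ∀ j, s j ≤ q (j + 1)) (N M : ℕ) :
    ∑ j ∈ Finset.Ico N M, s j ≤ 2 * q M :=
  calc ∑ j ∈ Finset.Ico N M, s j ≤ ∑ j ∈ Finset.range M, s j :=
        Finset.sum_le_sum_of_subset fun j hj => Finset.mem_range.2 (Finset.mem_Ico.1 hj).2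
    _ ≤ ∑ j ∈ Finset.range M, q (j + 1) := Finset.sum_le_sum fun j _ => hs j
    _ ≤ ∑ j ∈ Finset.range (M + 1), q j := by rw [Finset.sum_range_succ']; omega
    _ ≤ 2 * q M := by rw [Finset.sum_range_succ]; have := h.sum_range_le M; omega

theorem norm_sum_Ico_nsmul_le (h : SuperLacunary a q) (hs : ∀ j, ‖s j • a‖ ≤ 1 / (2 * q j))
    (hNM : N ≤ M) : ‖(∑ j ∈ Finset.Ico N M, s j) • a‖ ≤ 1 / q N := by
  rw [Finset.sum_smul]
  calc ‖∑ j ∈ Finset.Ico N M, s j • a‖ ≤ ∑ j ∈ Finset.Ico N M, 1 / (2 * (q j : ℝ)) :=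
        norm_sum_le_of_le _ fun j _ => hs j
    _ = 1 / 2 * ∑ j ∈ Finset.Ico N M, 1 / (q j : ℝ) := by
        rw [Finset.mul_sum]
        exact Finset.sum_congr rfl fun j _ => (one_div_mul_one_div 2 (q j : ℝ)).symm
    _ ≤ 1 / 2 * (2 / q N) := by gcongr; exact h.sum_Ico_inv_le hNM
    _ = 1 / q N := by ring

theorem norm_nsmul_nsmul_le (h : SuperLacunary a q) {n u : ℕ} (hu : u ≤ 2 * q n) :
    ‖u • q n • a‖ ≤ 1 / q n := by
  have hq := h.cast_pos n
  have hu' : (u : ℝ) ≤ 2 * q n := by exact_mod_cast hu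
  calc ‖u • q n • a‖ ≤ u * ‖q n • a‖ := norm_nsmul_le
    _ ≤ 2 * q n * (1 / (2 * (q n : ℝ) ^ 2)) := by gcongr; exact (h.norm_lt n).le
    _ = 1 / q n := by field_simp

theorem quarter_le_norm_nsmul_sum_Ico (h : SuperLacunary a q) (hs : ∀ j, s j ≤ q (j + 1))
    (hsmall : ∀ j, ‖s j • a‖ ≤ 1 / (2 * q j))
    (hhalf : ∀ j, 1 / 2 - 1 / (2 * q j) ≤ ‖q j • s j • a‖) {n : ℕ} (hn : 4 ≤ n) (hNn : N ≤ n)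
    (hnM : n < M) : 1 / 4 ≤ ‖q n • (∑ j ∈ Finset.Ico N M, s j) • a‖ := by
  set u := ∑ j ∈ Finset.Ico N n, s j
  set v := ∑ j ∈ Finset.Ico (n + 1) M, s j
  have hsplit : q n • (∑ j ∈ Finset.Ico N M, s j) • a =
      q n • s n • a + (u • q n • a + q n • v • a) := by
    rw [← Finset.sum_Ico_consecutive _ hNn hnM.le, Finset.sum_eq_sum_Ico_succ_bot hnM,
      add_smul, add_smul, smul_add, smul_add, smul_comm u]
    abel
  have hearlier : ‖u • q n • a‖ ≤ 1 / q n := h.norm_nsmul_nsmul_le (h.sum_Ico_le hs N n)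
  have hlater : ‖q n • v • a‖ ≤ (1 / 2) ^ n :=
    calc ‖q n • v • a‖ ≤ q n * (1 / q (n + 1)) :=
          norm_nsmul_le.trans (by gcongr; exact h.norm_sum_Ico_nsmul_le hsmall hnM)
      _ ≤ (1 / 2) ^ n := by rw [mul_one_div]; exact h.div_succ_le n
  have hinv := h.inv_le n
  have hpow : (1 / 2 : ℝ) ^ n ≤ (1 / 2) ^ 4 :=
    pow_le_pow_of_le_one (by norm_num) (by norm_num) hn
  have hcurrent := hhalf n
  rw [show 1 / (2 * (q n : ℝ)) = 1 / 2 * (1 / q n) by ring] at hcurrent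
  have htriangle := norm_sub_le_norm_add (q n • s n • a) (u • q n • a + q n • v • a)
  rw [hsplit]
  linarith [norm_add_le (u • q n • a) (q n • v • a)]

theorem exists_return_time (h : SuperLacunary a q) (hN : 4 ≤ N) (hNM : N ≤ M) :
    ∃ t ≤ 2 * q M, ‖t • a‖ ≤ 1 / q N ∧ ∀ n, N ≤ n → n < M → 1 / 4 ≤ ‖q n • t • a‖ := by
  choose s hs hsmall hhalf using fun j =>
    exists_nsmul_near_half_period (h.one_le j) (h.norm_lt j) (h.half_le j)
  exact ⟨∑ j ∈ Finset.Ico N M, s j, h.sum_Ico_le hs N M, h.norm_sum_Ico_nsmul_le hsmall hNM,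
    fun n hNn hnM => h.quarter_le_norm_nsmul_sum_Ico hs hsmall hhalf (hN.trans hNn) hNn hnM⟩

end ReturnTimes

end SuperLacunary

end SuperLacunarySequences

section TranslationCorrelation

variable {ψ : UnitAddCircle → ℂ}

theorem continuous_integral_translate_mul_conj
    (hψ : MemLp ψ 2 (volume : Measure UnitAddCircle)) :
    Continuous fun θ : UnitAddCircle => ∫ x, ψ (x + θ) * starRingEnd ℂ (ψ x) := by
  let translation : C(UnitAddCircle, C(UnitAddCircle, UnitAddCircle)) :=
    ContinuousMap.curry ⟨fun p => p.2 + p.1, by fun_prop⟩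
  have hpres (θ) : MeasurePreserving (translation θ) (volume : Measure UnitAddCircle) volume :=
    measurePreserving_add_right volume θ
  have hcont : Continuous fun θ => Lp.compMeasurePreserving (translation θ) (hpres θ)
      (hψ.toLp ψ) :=
    Continuous.compMeasurePreservingLp continuous_const translation.continuous hpres (by simp)
  refine ((continuous_const (y := hψ.toLp ψ)).inner (𝕜 := ℂ) hcont).congr fun θ => ?_
  rw [L2.inner_def]
  refine integral_congr_ae ?_
  filter_upwards [hψ.coeFn_toLp, Lp.coeFn_compMeasurePreserving (hψ.toLp ψ) (hpres θ),
    (hpres θ).quasiMeasurePreserving.ae hψ.coeFn_toLp] with x hx hcomp hxθ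
  rw [hcomp, hx, RCLike.inner_apply, Function.comp_apply, hxθ]
  rfl

theorem eventually_lt_norm_integral_translate_mul_conj (hψ : Measurable ψ)
    (hψ1 : ∀ᵐ x, ‖ψ x‖ = 1) {r : ℝ} (hr : r < 1) :
    ∀ᶠ θ in 𝓝 (0 : UnitAddCircle), r < ‖∫ x, ψ (x + θ) * starRingEnd ℂ (ψ x)‖ := by
  have hmem : MemLp ψ 2 (volume : Measure UnitAddCircle) :=
    MemLp.of_bound hψ.aestronglyMeasurable 1 (hψ1.mono fun x hx => hx.le)
  have hzero : ∫ x, ψ (x + 0) * starRingEnd ℂ (ψ x) = 1 := by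
    rw [integral_congr_ae (g := fun _ => (1 : ℂ))]
    · simp
    · filter_upwards [hψ1] with x hx
      rw [add_zero, Complex.mul_conj, Complex.normSq_eq_norm_sq, hx, one_pow, Complex.ofReal_one]
  refine (continuous_integral_translate_mul_conj hmem).norm.continuousAt.eventually_const_lt ?_
  simpa only [hzero, norm_one] using hr

end TranslationCorrelation

section LacunaryCocycles

/-- The coefficients of the difference `f (x + θ) - f x`, where `f` is the (formal) sum of the waves
`wave (b n) (q n)`. -/
noncomputable def differenceCoeff (b : ℕ → ℂ) (q : ℕ → ℕ) (θ : UnitAddCircle) (n : ℕ) : ℂ :=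
  b n * (fourier (q n : ℤ) θ - 1)

variable {a θ : UnitAddCircle} {q : ℕ → ℕ} {b : ℕ → ℂ} {K B : ℝ} {N M t : ℕ}

theorem differenceCoeff_add (b : ℕ → ℂ) (q : ℕ → ℕ) (θ a : UnitAddCircle) (n : ℕ) :
    differenceCoeff b q (θ + a) n =
      differenceCoeff b q θ n + differenceCoeff b q a n * fourier (q n : ℤ) θ := by
  simp only [differenceCoeff, fourier_apply_add]
  ring

theorem norm_differenceCoeff_nsmul_le (b : ℕ → ℂ) (q : ℕ → ℕ) (a : UnitAddCircle) (t n : ℕ) :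
    ‖differenceCoeff b q (t • a) n‖ ≤ t * ‖differenceCoeff b q a n‖ := by
  induction t with
  | zero => simp [differenceCoeff]
  | succ t ih =>
    rw [succ_nsmul, differenceCoeff_add]
    refine (norm_add_le _ _).trans ?_
    rw [norm_mul, norm_fourier_apply, mul_one, Nat.cast_add, Nat.cast_one, add_one_mul]
    gcongr

theorem norm_differenceCoeff_le_two_mul (b : ℕ → ℂ) (q : ℕ → ℕ) (θ : UnitAddCircle) (n : ℕ) :
    ‖differenceCoeff b q θ n‖ ≤ 2 * ‖b n‖ := by
  rw [differenceCoeff, norm_mul, mul_comm]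
  gcongr
  refine (norm_sub_le _ _).trans_eq ?_
  rw [norm_fourier_apply, norm_one, one_add_one_eq_two]

theorem norm_differenceCoeff_le_norm_nsmul (b : ℕ → ℂ) (q : ℕ → ℕ) (θ : UnitAddCircle) (n : ℕ) :
    ‖differenceCoeff b q θ n‖ ≤ ‖b n‖ * (2 * Real.pi * ‖q n • θ‖) := by
  rw [differenceCoeff, norm_mul, ← natCast_zsmul]
  gcongr
  exact norm_fourier_sub_one_le _ _

theorem norm_le_norm_differenceCoeff {n : ℕ} (hθ : 1 / 4 ≤ ‖q n • θ‖) :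
    ‖b n‖ ≤ ‖differenceCoeff b q θ n‖ := by
  have hfourier := four_mul_norm_le_norm_fourier_sub_one (q n : ℤ) θ
  rw [natCast_zsmul] at hfourier
  rw [differenceCoeff, norm_mul]
  exact le_mul_of_one_le_right (norm_nonneg _) (by linarith)

theorem wave_add_left (d d' : ℂ) (q : ℕ) (x : UnitAddCircle) :
    wave (d + d') q x = wave d q x + wave d' q x := by
  rw [wave, add_mul, Complex.add_re, wave, wave]

theorem wave_differenceCoeff_add (b : ℕ → ℂ) (q : ℕ → ℕ) (θ a x : UnitAddCircle) (n : ℕ) :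
    wave (differenceCoeff b q (θ + a) n) (q n) x =
      wave (differenceCoeff b q θ n) (q n) x + wave (differenceCoeff b q a n) (q n) (x + θ) := by
  rw [differenceCoeff_add, wave_add_left, wave_apply_add]

theorem summable_wave {d : ℕ → ℂ} (hd : Summable fun n => ‖d n‖) (q : ℕ → ℕ) (x : UnitAddCircle) :
    Summable fun n => wave (d n) (q n) x :=
  Summable.of_norm_bounded hd fun _ => abs_wave_le _ _ _

theorem ae_cocycle_nsmul (hb : Summable fun n => ‖differenceCoeff b q a n‖) {c : ℝ}
    {ψ : UnitAddCircle → ℂ}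
    (hψ : ∀ᵐ x, ψ (x + a) = Complex.exp ((c + ∑' n, wave (differenceCoeff b q a n) (q n) x : ℝ) *
      Complex.I) * ψ x) (t : ℕ) :
    ∀ᵐ x, ψ (x + t • a) = Complex.exp ((t * c +
      ∑' n, wave (differenceCoeff b q (t • a) n) (q n) x : ℝ) * Complex.I) * ψ x := by
  induction t with
  | zero => simp [wave, differenceCoeff]
  | succ t ih =>
    have hbt : Summable fun n => ‖differenceCoeff b q (t • a) n‖ :=
      (hb.mul_left (t : ℝ)).of_nonneg_of_le (fun _ => norm_nonneg _)
        (norm_differenceCoeff_nsmul_le b q a t)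
    filter_upwards [ih, (measurePreserving_add_right volume (t • a)).quasiMeasurePreserving.ae hψ]
      with x hx hxt
    simp_rw [succ_nsmul, wave_differenceCoeff_add]
    rw [(summable_wave hbt q x).tsum_add (summable_wave hb q (x + t • a)), ← add_assoc, hxt, hx,
      ← mul_assoc, ← Complex.exp_add]
    congr 2
    push_cast
    ring

theorem norm_integral_translate_mul_conj (hb : Summable fun n => ‖differenceCoeff b q a n‖) {c : ℝ}
    {ψ : UnitAddCircle → ℂ} (hψ1 : ∀ᵐ x, ‖ψ x‖ = 1)
    (hψ : ∀ᵐ x, ψ (x + a) = Complex.exp ((c + ∑' n, wave (differenceCoeff b q a n) (q n) x : ℝ) *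
      Complex.I) * ψ x) (t : ℕ) :
    ‖∫ x, ψ (x + t • a) * starRingEnd ℂ (ψ x)‖ =
      ‖∫ x, Complex.exp ((∑' n, wave (differenceCoeff b q (t • a) n) (q n) x : ℝ) *
        Complex.I)‖ := by
  have hfactor : ∫ x, ψ (x + t • a) * starRingEnd ℂ (ψ x) =
      Complex.exp ((t * c : ℝ) * Complex.I) * ∫ x,
        Complex.exp ((∑' n, wave (differenceCoeff b q (t • a) n) (q n) x : ℝ) * Complex.I) := by
    rw [← integral_const_mul]
    refine integral_congr_ae ?_
    filter_upwards [ae_cocycle_nsmul hb hψ t, hψ1] with x hx hx1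
    rw [hx, mul_assoc, Complex.mul_conj, Complex.normSq_eq_norm_sq, hx1, one_pow,
      Complex.ofReal_one, mul_one, ← Complex.exp_add, Complex.ofReal_add, add_mul]
  rw [hfactor, norm_mul, Complex.norm_exp_ofReal_mul_I, one_mul]

theorem norm_integral_cexp_tsum_wave_le {d : ℕ → ℂ} (hd : Summable fun n => ‖d n‖) (q : ℕ → ℕ)
    (hNM : N ≤ M) :
    ‖∫ x, Complex.exp ((∑' n, wave (d n) (q n) x : ℝ) * Complex.I)‖ ≤
      ‖∫ x, Complex.exp ((∑ n ∈ Finset.Ico N M, wave (d n) (q n) x : ℝ) * Complex.I)‖ +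
        (∑ n ∈ Finset.range N, ‖d n‖ + ∑' n, ‖d (n + M)‖) := by
  have hcont : Continuous fun x => ∑' n, wave (d n) (q n) x :=
    continuous_tsum (fun n => continuous_wave _ _) hd fun n x => abs_wave_le _ _ _
  have herror : ∀ x, |∑' n, wave (d n) (q n) x - ∑ n ∈ Finset.Ico N M, wave (d n) (q n) x| ≤
      ∑ n ∈ Finset.range N, ‖d n‖ + ∑' n, ‖d (n + M)‖ := fun x => by
    rw [← (summable_wave hd q x).sum_add_tsum_nat_add M, ← Finset.sum_range_add_sum_Ico _ hNM,
      add_right_comm, add_sub_cancel_right]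
    refine (abs_add_le _ _).trans (add_le_add ?_ ?_)
    · exact (Finset.abs_sum_le_sum_abs _ _).trans (Finset.sum_le_sum fun n _ => abs_wave_le _ _ _)
    · exact tsum_of_norm_bounded (f := fun n => wave (d (n + M)) (q (n + M)) x)
        ((summable_nat_add_iff M).2 hd).hasSum fun n => abs_wave_le _ _ _
  refine (norm_le_norm_add_norm_sub' _
    (∫ x, Complex.exp ((∑ n ∈ Finset.Ico N M, wave (d n) (q n) x : ℝ) * Complex.I))).trans ?_
  gcongr
  rw [← integral_sub (integrable_of_continuous (by fun_prop))
    (integrable_of_continuous (by fun_prop))]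
  simpa using norm_integral_le_of_norm_le_const (μ := volume)
    (ae_of_all _ fun x => (norm_cexp_sub_cexp_le _ _).trans (herror x))

namespace SuperLacunary

theorem sum_range_norm_differenceCoeff_le (h : SuperLacunary a q) (hB : ∀ n, ‖b n‖ ≤ B)
    (hθ : ‖θ‖ ≤ 1 / q N) :
    ∑ n ∈ Finset.range N, ‖differenceCoeff b q θ n‖ ≤ 8 * Real.pi * B * (1 / 2) ^ N := by
  have hB0 : 0 ≤ B := (norm_nonneg _).trans (hB 0)
  have hterm : ∀ n, ‖differenceCoeff b q θ n‖ ≤ 2 * Real.pi * B * (q n / q N) := fun n =>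
    calc ‖differenceCoeff b q θ n‖ ≤ ‖b n‖ * (2 * Real.pi * ‖q n • θ‖) :=
          norm_differenceCoeff_le_norm_nsmul b q θ n
      _ ≤ B * (2 * Real.pi * (q n * (1 / q N))) := by
          gcongr
          exacts [hB n, norm_nsmul_le.trans (by gcongr)]
      _ = 2 * Real.pi * B * (q n / q N) := by ring
  calc ∑ n ∈ Finset.range N, ‖differenceCoeff b q θ n‖
      ≤ ∑ n ∈ Finset.range N, 2 * Real.pi * B * (q n / q N) := Finset.sum_le_sum fun n _ => hterm n
    _ = 2 * Real.pi * B * ((∑ n ∈ Finset.range N, (q n : ℝ)) / q N) := by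
        rw [← Finset.mul_sum, Finset.sum_div]
    _ ≤ 2 * Real.pi * B * (4 * (1 / 2) ^ N) := by gcongr; exact h.sum_range_div_le N
    _ = 8 * Real.pi * B * (1 / 2) ^ N := by ring

theorem summable_norm_differenceCoeff (h : SuperLacunary a q) (hK0 : 0 ≤ K)
    (hK : ∀ n, ‖differenceCoeff b q a n‖ ≤ K / (q n : ℝ) ^ 2) :
    Summable fun n => ‖differenceCoeff b q a n‖ := by
  refine (summable_geometric_two.mul_left K).of_nonneg_of_le (fun _ => norm_nonneg _) fun n => ?_
  have hq : (1 : ℝ) ≤ q n := by exact_mod_cast h.one_le n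
  calc ‖differenceCoeff b q a n‖ ≤ K * (1 / (q n : ℝ) ^ 2) := by rw [mul_one_div]; exact hK n
    _ ≤ K * (1 / q n) := by gcongr; exact le_self_pow₀ hq two_ne_zero
    _ ≤ K * (1 / 2) ^ n := by gcongr; exact h.inv_le n

theorem tsum_norm_differenceCoeff_le (h : SuperLacunary a q) (hK0 : 0 ≤ K)
    (hK : ∀ n, ‖differenceCoeff b q a n‖ ≤ K / (q n : ℝ) ^ 2) (ht : t ≤ 2 * q M) :
    ∑' n, ‖differenceCoeff b q (t • a) (n + M)‖ ≤ 4 * K * (1 / 2) ^ M := by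
  have hterm : ∀ n, ‖differenceCoeff b q (t • a) (n + M)‖ ≤ 2 * K * (1 / 2) ^ M * (1 / 2) ^ n := by
    intro n
    have hq := h.cast_pos (n + M)
    have ht' : (t : ℝ) ≤ 2 * q (n + M) := by
      exact_mod_cast ht.trans (Nat.mul_le_mul_left 2 (h.monotone (Nat.le_add_left M n)))
    calc ‖differenceCoeff b q (t • a) (n + M)‖ ≤ t * ‖differenceCoeff b q a (n + M)‖ :=
          norm_differenceCoeff_nsmul_le _ _ _ _ _
      _ ≤ 2 * q (n + M) * (K / (q (n + M) : ℝ) ^ 2) := by gcongr; exact hK _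
      _ = 2 * K * (1 / q (n + M)) := by field_simp
      _ ≤ 2 * K * (1 / 2) ^ (n + M) := by gcongr; exact h.inv_le _
      _ = 2 * K * (1 / 2) ^ M * (1 / 2) ^ n := by ring
  have hgeometric : Summable fun n : ℕ => 2 * K * (1 / 2) ^ M * (1 / 2) ^ n :=
    summable_geometric_two.mul_left _
  refine ((hgeometric.of_nonneg_of_le (fun _ => norm_nonneg _) hterm).tsum_le_tsum hterm
    hgeometric).trans_eq ?_
  rw [tsum_mul_left, tsum_geometric_two]
  ring

theorem exists_return_time_norm_integral_le (h : SuperLacunary a q) (hK0 : 0 ≤ K)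
    (hK : ∀ n, ‖differenceCoeff b q a n‖ ≤ K / (q n : ℝ) ^ 2) (hB : ∀ n, ‖b n‖ ≤ B) (hN : 4 ≤ N)
    (hb : ∀ n, N ≤ n → ‖b n‖ ≤ 1 / 2) (hNM : N ≤ M) :
    ∃ t : ℕ, ‖t • a‖ ≤ (1 / 2) ^ N ∧
      ‖∫ x, Complex.exp ((∑' n, wave (differenceCoeff b q (t • a) n) (q n) x : ℝ) * Complex.I)‖ ≤
        Real.exp (-∑ n ∈ Finset.Ico N M, ‖b n‖ ^ 2 / 8) +
          (16 * Real.pi + 8 * Real.pi * B + 4 * K) * (1 / 2) ^ N := by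
  obtain ⟨t, htM, hta, hhalf⟩ := h.exists_return_time hN hNM
  refine ⟨t, hta.trans (h.inv_le N), ?_⟩
  have hsummable : Summable fun n => ‖differenceCoeff b q (t • a) n‖ :=
    ((h.summable_norm_differenceCoeff hK0 hK).mul_left (t : ℝ)).of_nonneg_of_le
      (fun _ => norm_nonneg _) (norm_differenceCoeff_nsmul_le b q a t)
  have hle_one : ∀ n, N ≤ n → ‖differenceCoeff b q (t • a) n‖ ≤ 1 := fun n hn =>
    (norm_differenceCoeff_le_two_mul b q _ n).trans (by linarith [hb n hn])
  have hexp : Real.exp (-∑ n ∈ Finset.Ico N M, ‖differenceCoeff b q (t • a) n‖ ^ 2 / 8) ≤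
      Real.exp (-∑ n ∈ Finset.Ico N M, ‖b n‖ ^ 2 / 8) := by
    gcongr with n hn
    exact norm_le_norm_differenceCoeff (hhalf n (Finset.mem_Ico.1 hn).1 (Finset.mem_Ico.1 hn).2)
  have hgeometric : 8 * Real.pi * ∑ n ∈ Finset.Ico N M, (1 / 2 : ℝ) ^ n ≤
      8 * Real.pi * (2 * (1 / 2) ^ N) := by
    gcongr
    exact (geom_sum_Ico_le_of_lt_one (by norm_num) (by norm_num)).trans_eq (by ring)
  have hhigh : 4 * K * (1 / 2 : ℝ) ^ M ≤ 4 * K * (1 / 2) ^ N := by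
    gcongr 4 * K * ?_
    exact pow_le_pow_of_le_one (by norm_num) (by norm_num) hNM
  linarith [norm_integral_cexp_tsum_wave_le hsummable q hNM,
    h.norm_integral_cexp_sum_wave_le hle_one hNM,
    h.sum_range_norm_differenceCoeff_le hB hta, h.tsum_norm_differenceCoeff_le hK0 hK htM]

end SuperLacunary

theorem exists_exp_neg_sum_Ico_lt {f : ℕ → ℝ} (hf0 : ∀ n, 0 ≤ f n) (hf : ¬ Summable f) (N : ℕ)
    {ε : ℝ} (hε : 0 < ε) : ∃ M, N ≤ M ∧ Real.exp (-∑ n ∈ Finset.Ico N M, f n) < ε := by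
  have hsum : Tendsto (fun M => ∑ n ∈ Finset.Ico N M, f n) atTop atTop := by
    refine (tendsto_atTop_add_const_right atTop (-∑ n ∈ Finset.range N, f n)
      ((not_summable_iff_tendsto_nat_atTop_of_nonneg hf0).1 hf)).congr' ?_
    filter_upwards [eventually_ge_atTop N] with M hM
    rw [Finset.sum_Ico_eq_sub _ hM, sub_eq_add_neg]
  exact ((eventually_ge_atTop N).and
    ((Real.tendsto_exp_neg_atTop_nhds_zero.comp hsum).eventually_lt_const hε)).exists

theorem SuperLacunary.not_ae_cocycle (h : SuperLacunary a q) (hK0 : 0 ≤ K)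
    (hK : ∀ n, ‖differenceCoeff b q a n‖ ≤ K / (q n : ℝ) ^ 2)
    (hb : Tendsto b atTop (𝓝 0)) (hb2 : ¬ Summable fun n => ‖b n‖ ^ 2) (c : ℝ)
    {ψ : UnitAddCircle → ℂ} (hψ : Measurable ψ) (hψ1 : ∀ᵐ x, ‖ψ x‖ = 1) :
    ¬ ∀ᵐ x, ψ (x + a) = Complex.exp ((c + ∑' n, wave (differenceCoeff b q a n) (q n) x : ℝ) *
      Complex.I) * ψ x := by
  intro hcocycle
  obtain ⟨δ, hδ, hcorrelation⟩ := Metric.eventually_nhds_iff.1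
    (eventually_lt_norm_integral_translate_mul_conj hψ hψ1 one_half_lt_one)
  obtain ⟨B, hB⟩ := hb.norm.bddAbove_range
  have hgeometric : Tendsto (fun n : ℕ => (1 / 2 : ℝ) ^ n) atTop (𝓝 0) :=
    tendsto_pow_atTop_nhds_zero_of_lt_one (by norm_num) (by norm_num)
  have herror : Tendsto (fun n : ℕ => (16 * Real.pi + 8 * Real.pi * B + 4 * K) * (1 / 2 : ℝ) ^ n)
      atTop (𝓝 0) := by
    simpa only [mul_zero] using hgeometric.const_mul (16 * Real.pi + 8 * Real.pi * B + 4 * K)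
  have hsmall : ∀ᶠ N in atTop, ∀ n, N ≤ n → ‖b n‖ < 1 / 2 :=
    eventually_forall_ge_atTop.2 (hb.norm.eventually_lt_const (by simp))
  obtain ⟨N, hN, hNδ, hNerror, hNsmall⟩ := ((eventually_ge_atTop 4).and
    ((hgeometric.eventually_lt_const hδ).and
      ((herror.eventually_lt_const (show (0 : ℝ) < 1 / 4 by norm_num)).and hsmall))).exists
  obtain ⟨M, hNM, hM⟩ := exists_exp_neg_sum_Ico_lt (f := fun n => ‖b n‖ ^ 2 / 8)
    (fun n => by positivity) (fun hs => hb2 ((hs.mul_left 8).congr fun n => by ring)) N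
    (show (0 : ℝ) < 1 / 4 by norm_num)
  obtain ⟨t, hta, ht⟩ := h.exists_return_time_norm_integral_le hK0 hK (fun n => hB ⟨n, rfl⟩) hN
    (fun n hn => (hNsmall n hn).le) hNM
  have hlarge : 1 / 2 < ‖∫ x, ψ (x + t • a) * starRingEnd ℂ (ψ x)‖ :=
    hcorrelation (by rw [dist_zero_right]; exact hta.trans_lt hNδ)
  rw [norm_integral_translate_mul_conj (h.summable_norm_differenceCoeff hK0 hK) hψ1 hcocycle]
    at hlarge
  linarith

end LacunaryCocycles

section EigenfunctionEquation

variable {α ν : ℝ} {φ : UnitAddCircle → ℝ} {c : ℤ → ℂ}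

theorem continuous_of_continuous_comp_coe {X : Type*} [TopologicalSpace X] {f : UnitAddCircle → X}
    (hf : Continuous fun x : ℝ => f (x : UnitAddCircle)) : Continuous f :=
  isQuotientMap_quotient_mk'.continuous_iff.2 hf

theorem exists_superLacunary_range_eq_goodDenominators (hinf : (goodDenominators α).Infinite) :
    ∃ q : ℕ → ℕ, SuperLacunary α q ∧ Set.range q = goodDenominators α := by
  let q := Nat.nth (· ∈ goodDenominators α)
  have hmem : ∀ n, q n ∈ goodDenominators α := Nat.nth_mem_of_infinite hinf
  have hlt : ∀ n, q n < q (n + 1) := fun n => Nat.nth_strictMono hinf n.lt_succ_self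
  refine ⟨q, ?_, Nat.range_nth_of_infinite hinf⟩
  exact {
    one_le := fun n => (hmem n).1
    lt_succ := hlt
    sq_le := fun n => sq_le_of_lt_of_mem_goodDenominators (hmem n) (hmem _) (hlt n)
    norm_lt := fun n => norm_nsmul_lt_of_mem_goodDenominators (hmem n)
    half_le := fun n => half_le_mul_norm_nsmul (hmem n) (hmem _) (hlt n) }

theorem ae_cocycle_mul_exp_of_cohomologous {a : UnitAddCircle} {g W : UnitAddCircle → ℝ}
    {ψ : UnitAddCircle → ℂ} (hφ : ∀ᵐ x, φ x = g x + (W (x + a) - W x))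
    (hψ : ∀ᵐ x, ψ (x + a) = Complex.exp (ν * φ x * Complex.I) * ψ x) :
    ∀ᵐ x, ψ (x + a) * Complex.exp ((-(ν * W (x + a)) : ℝ) * Complex.I) =
      Complex.exp ((ν * g x : ℝ) * Complex.I) *
        (ψ x * Complex.exp ((-(ν * W x) : ℝ) * Complex.I)) := by
  filter_upwards [hφ, hψ] with x hφx hψx
  rw [hψx, hφx, mul_right_comm, ← Complex.exp_add, mul_comm (ψ x), ← mul_assoc, ← Complex.exp_add]
  congr 2
  push_cast
  ring

theorem tsum_wave_comp_eq_mul_tsum_indicator {q : ℕ → ℕ} (hq : Function.Injective q) (ν : ℝ)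
    (d : ℕ → ℂ) (x : UnitAddCircle) :
    ∑' n, wave (2 * ν * d (q n)) (q n) x =
      ν * ∑' m, (Set.range q).indicator (fun m => wave (2 * d m) m x) m := by
  rw [← hq.tsum_eq Set.support_indicator_subset, ← tsum_mul_left]
  refine tsum_congr fun n => ?_
  rw [Set.indicator_of_mem (Set.mem_range_self n), wave, wave, mul_comm 2 (ν : ℂ), mul_assoc,
    mul_assoc, Complex.re_ofReal_mul, mul_assoc]

theorem differenceCoeff_transferCoeff (hα : Irrational α) (ν : ℝ) (c : ℤ → ℂ) {q : ℕ → ℕ} {n : ℕ}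
    (hq : q n ≠ 0) :
    differenceCoeff (fun n => 2 * ν * transferCoeff c α (q n)) q α n = 2 * ν * c (q n) := by
  rw [differenceCoeff, mul_assoc, transferCoeff_mul hα c (Nat.cast_ne_zero.2 hq)]

theorem tendsto_transferCoeff_comp {a : UnitAddCircle} {q : ℕ → ℕ} (hq : Tendsto q atTop atTop)
    (hlim : Tendsto (fun m : ℕ => coeffRatio c a m) atTop (𝓝 0)) (w : ℂ) :
    Tendsto (fun n => w * transferCoeff c a (q n)) atTop (𝓝 0) := by
  have htransfer : Tendsto (fun n => transferCoeff c a (q n)) atTop (𝓝 0) :=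
    squeeze_zero_norm (fun n => norm_transferCoeff_le c a (q n)) (hlim.comp hq)
  simpa only [mul_zero] using htransfer.const_mul w

theorem not_summable_transferCoeff_sq_comp {a : UnitAddCircle} {q : ℕ → ℕ}
    (hq : Function.Injective q)
    (hc : ¬ Summable ((Set.range q).indicator fun m : ℕ => coeffRatio c a m ^ 2)) {w : ℂ}
    (hw : w ≠ 0) : ¬ Summable fun n => ‖w * transferCoeff c a (q n)‖ ^ 2 := by
  intro hsum
  simp only [norm_mul, mul_pow] at hsum
  rw [summable_mul_left_iff (pow_ne_zero 2 (norm_ne_zero_iff.2 hw))] at hsum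
  refine hc ((hq.summable_iff fun m hm => Set.indicator_of_notMem hm _).1 ?_)
  refine (hsum.mul_left ((2 * Real.pi) ^ 2)).of_nonneg_of_le
    (fun n => Set.indicator_nonneg (fun _ _ => sq_nonneg _) _) fun n => ?_
  rw [Function.comp_apply, Set.indicator_of_mem (Set.mem_range_self n), ← mul_pow]
  exact pow_le_pow_left₀ (coeffRatio_nonneg c a _) (coeffRatio_le_norm_transferCoeff c a _) 2

theorem SuperLacunary.not_ae_cocycle_roof {q : ℕ → ℕ} (h : SuperLacunary α q)
    (hα : Irrational α) (hφ : Continuous φ)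
    (hdecay : Summable fun m : ℤ => ((m : ℝ) ^ 2 * ‖roofCoeff φ m‖) ^ 2)
    (hcompl : Summable
      ((Set.range q)ᶜ.indicator fun m : ℕ => coeffRatio (roofCoeff φ) α m ^ 2))
    (hrange : ¬ Summable
      ((Set.range q).indicator fun m : ℕ => coeffRatio (roofCoeff φ) α m ^ 2))
    (hlim : Tendsto (fun m : ℕ => coeffRatio (roofCoeff φ) α m) atTop (𝓝 0))
    (hν : ν ≠ 0) {ψ : UnitAddCircle → ℂ} (hψ : Measurable ψ) (hψ1 : ∀ᵐ x, ‖ψ x‖ = 1) :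
    ¬ ∀ᵐ x, ψ (x + (α : UnitAddCircle)) = Complex.exp (ν * φ x * Complex.I) * ψ x := by
  intro hcocycle
  have hq0 : ∀ n, q n ≠ 0 := fun n => Nat.one_le_iff_ne_zero.1 (h.one_le n)
  have hmono : StrictMono q := strictMono_nat_of_lt_succ h.lt_succ
  obtain ⟨K, hK0, hK⟩ := exists_norm_le_div_sq hdecay
  obtain ⟨W, hWm, hW⟩ := exists_cohomologous_lacunary hα hφ (summable_norm_of_norm_le_div_sq hK)
    (P := Set.range q) (fun ⟨n, hn⟩ => hq0 n hn)
    (summable_indicator_int_coeffRatio_sq (roofCoeff_neg φ) hcompl)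
  have hdiff : ∀ n, differenceCoeff (fun n => 2 * ν * transferCoeff (roofCoeff φ) α (q n)) q α n =
      2 * ν * roofCoeff φ (q n) :=
    fun n => differenceCoeff_transferCoeff hα ν _ (hq0 n)
  refine h.not_ae_cocycle (K := ‖(2 * ν : ℂ)‖ * K) (by positivity) (fun n => ?_)
    (tendsto_transferCoeff_comp hmono.tendsto_atTop hlim (2 * ν))
    (not_summable_transferCoeff_sq_comp hmono.injective hrange
      (mul_ne_zero two_ne_zero (Complex.ofReal_ne_zero.2 hν)))
    (ν * (roofCoeff φ 0).re) (ψ := fun x => ψ x * Complex.exp ((-(ν * W x) : ℝ) * Complex.I))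
    (by fun_prop) ?_ ?_
  · rw [hdiff, norm_mul, mul_div_assoc]
    gcongr
    exact_mod_cast hK (q n) (Nat.cast_ne_zero.2 (hq0 n))
  · filter_upwards [hψ1] with x hx
    rw [norm_mul, hx, Complex.norm_exp_ofReal_mul_I, one_mul]
  · filter_upwards [ae_cocycle_mul_exp_of_cohomologous hW hcocycle] with x hx
    simp_rw [hdiff]
    rw [tsum_wave_comp_eq_mul_tsum_indicator hmono.injective ν (fun m => roofCoeff φ m), ← mul_add,
      hx]

end EigenfunctionEquation

theorem proposition4p2_general (φ : UnitAddCircle → ℝ) (hpos : ∀ x, 0 < φ x)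
    (hφ : Continuous φ)
    (hdecay : Summable fun m : ℤ => ((m : ℝ) ^ 2 * ‖roofCoeff φ m‖) ^ 2)
    (hreg : RegularCoeffs (roofCoeff φ))
    (α : ℝ) (hα : Irrational α)
    (hlim : Tendsto (fun m : ℕ =>
      ‖roofCoeff φ (m : ℤ)‖ / ‖((((m : ℝ) * α : ℝ)) : UnitAddCircle)‖) atTop (𝓝 0))
    (hsum : ¬ Summable (fun m : {m : ℤ // m ≠ 0} =>
      (‖roofCoeff φ (m : ℤ)‖ / ‖(((((m : ℤ) : ℝ) * α : ℝ)) : UnitAddCircle)‖) ^ 2)) :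
    IsWeakMixingFlow (specialMeasure φ) (specialFlow α φ) := by
  simp_rw [← nsmul_coe_unitAddCircle, ← coeffRatio_natCast] at hlim
  simp_rw [← zsmul_coe_unitAddCircle] at hsum
  obtain ⟨B, hB⟩ := hlim.bddAbove_range
  have hbound : ∀ m : ℤ, coeffRatio (roofCoeff φ) α m ≤ B := fun m => by
    obtain ⟨n, rfl | rfl⟩ := m.eq_nat_or_neg
    · exact hB ⟨n, rfl⟩
    · exact (coeffRatio_neg (roofCoeff_neg φ) n).trans_le (hB ⟨n, rfl⟩)
  have hbad := summable_indicator_compl_coeffRatio_sq hα hdecay hreg hbound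
  have hgood := not_summable_indicator_coeffRatio_sq (roofCoeff_neg φ) hbad
    fun hc => hsum (hc.comp_injective Subtype.val_injective)
  have hinf : (goodDenominators α).Infinite := fun hfin =>
    hgood (summable_of_hasFiniteSupport (hfin.subset Set.support_indicator_subset))
  obtain ⟨q, hq, hrange⟩ := exists_superLacunary_range_eq_goodDenominators hinf
  rw [← hrange] at hbad hgood
  exact isWeakMixingFlow_specialFlow hφ hpos hα fun ν ψ hν hψ hψ1 =>
    hq.not_ae_cocycle_roof hα hφ hdecay hbad hgood hlim hν hψ hψ1

theorem proposition4p2 (φ : UnitAddCircle → ℝ) (hpos : ∀ x, 0 < φ x)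
    (hφ : ContDiff ℝ 3 (fun x : ℝ => φ (x : UnitAddCircle)))
    (hreg : RegularCoeffs (roofCoeff φ))
    (α : ℝ) (hα : Irrational α)
    (hlim : Tendsto (fun m : ℕ =>
      ‖roofCoeff φ (m : ℤ)‖ / ‖((((m : ℝ) * α : ℝ)) : UnitAddCircle)‖) atTop (𝓝 0))
    (hsum : ¬ Summable (fun m : {m : ℤ // m ≠ 0} =>
      (‖roofCoeff φ (m : ℤ)‖ / ‖(((((m : ℤ) : ℝ) * α : ℝ)) : UnitAddCircle)‖) ^ 2)) :
    IsWeakMixingFlow (specialMeasure φ) (specialFlow α φ) :=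
  proposition4p2_general φ hpos (continuous_of_continuous_comp_coe hφ.continuous)
    (summable_sq_mul_norm_roofCoeff_sq hφ) hreg α hα hlim hsum
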